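/- Let $n,m\ge 1$ be integers. For an $m$-tuple $\vec f=(f_1,\dots,f_m)$ of locally integrable functions on $\mathbf R^n$, let $$\mathcal M_{\mathcal R}(\vec f\,)(x)=\sup_{R\ni x}\ \prod_{i=1}^m\left(\frac1{|R|}\int_R|f_i(y)|\,dy\right),\qquad x\in\mathbf R^n,$$ where the supremum is taken over all open rectangles $R\subset\mathbf R^n$ with sides parallel to the coordinate axes that contain $x$. For $t\ge 0$ let $\Phi_n(t)=t\,(1+(\log^+t)^{n-1})$, where $\log^+t=\max(\log t,0)$ for $t>0$, $\log^+0=0$, and $(\log^+ t)^0=1$; let $\Phi_n^{(k)}$ be the $k$-fold composition of $\Phi_n$ with itself, with $\Phi_n^{(0)}(t)=t$. (i) There is a constant $C\in(0,\infty)$ depending only on $m$ and $n$ such that for all $\lambda>0$ and all locally integrable functions $f_1,\dots,f_m$ on $\mathbf R^n$, $$\left|\left\{x\in\mathbf R^n:\ \mathcal M_{\mathcal R}(\vec f\,)(x)>\lambda^m\right\}\right|\le C\left\{\prod_{i=1}^m\int_{\mathbf R^n}\Phi_n^{(m)}\!\left(\frac{|f_i(x)|}{\lambda}\right)dx\right\}^{1/m}.$$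 Here both sides take values in $[0,\infty]$, and $0\cdot\infty=0$. (ii) If $n\ge 2$, the estimate is sharp in the sense that $\Phi_n^{(m)}$ cannot be replaced by $\Phi_n^{(k)}$ for any $0\le k\le m-1$: for each such $k$ there is no constant $C\in(0,\infty)$ such that the inequality in (i), with $\Phi_n^{(k)}$ in place of $\Phi_n^{(m)}$, holds for all $\lambda>0$ and all locally integrable $f_1,\dots,f_m$ on $\mathbf R^n$. -/

import Mathlib

open MeasureTheory Set
open scoped ENNReal

/-- The basis `𝓡` of nonempty, bounded, open rectangles in `ℝⁿ` with sides parallel to the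
coordinate axes. -/
def openRectangles (n : ℕ) : Set (Set (Fin n → ℝ)) :=
  {R | ∃ a b : Fin n → ℝ, (∀ j, a j < b j) ∧ R = Set.univ.pi fun j => Ioo (a j) (b j)}

/-- The strong multilinear maximal function: the supremum, over all rectangles `R` containing `x`,
of the product of the averages of `|f i|` over `R`. It takes values in `[0, ∞]`. -/
noncomputable def strongMaximal {n m : ℕ} (f : Fin m → (Fin n → ℝ) → ℂ) (x : Fin n → ℝ) : ℝ≥0∞ :=
  ⨆ R ∈ {R ∈ openRectangles n | x ∈ R}, ∏ i, ⨍⁻ y in R, ‖f i y‖ₑ ∂volume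

/-- `Φₙ(t) = t (1 + (log⁺ t)ⁿ⁻¹)`, for `n ≥ 1`; its `m`-fold composition is `(Phi n)^[m]`. -/
noncomputable def Phi (n : ℕ) (t : ℝ) : ℝ := t * (1 + (Real.posLog t) ^ (n - 1))

/-- The `m`-linear distributional estimate for the strong maximal function on `ℝⁿ`, with
function `Φ` and constant `C`. Both sides are computed in `[0, ∞]`. -/
def DistributionalEstimate (n m : ℕ) (Φ : ℝ → ℝ) (C : ℝ) : Prop :=
  ∀ lam : ℝ, 0 < lam → ∀ f : Fin m → (Fin n → ℝ) → ℂ, (∀ i, LocallyIntegrable (f i) volume) →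
    volume {x : Fin n → ℝ | ENNReal.ofReal (lam ^ m) < strongMaximal f x} ≤
      ENNReal.ofReal C *
        (∏ i, ∫⁻ x : Fin n → ℝ, ENNReal.ofReal (Φ (‖f i x‖ / lam))) ^ (1 / (m : ℝ))

/-! For one function, part (i) is the Jessen–Marcinkiewicz–Zygmund estimate. Rectangle averages are
at most `2 ^ n` times an iterate of one-dimensional maximal operators
(`setLAverage_le_iterMaximal`). The one-dimensional weak (1,1) bound, truncated at the level and
summed over dyadic levels, costs one logarithm per inner operator; the outermost operator needs only
the weak bound, so n - 1 logarithms remain (`exists_volume_rectangle_average_le`).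

For m functions let E be `superlevel u` and I_i the integral of Φ^(m)(u_i). If ∏ t_i ≤ 1, a product
of averages above 1 forces some average above t_i, on a rectangle contained in E; hence |E| ≤ A ∑
∫_E Φ(u_i / t_i) (`exists_volume_superlevel_le`). Take t_i = K τ_i, where τ_i solves `balance` (τ_i)
= I_i / |E|. By `Phi_div_le_balance` the right side is then at most |E| / 2, which is absurd when 0
< |E| < ∞. So ∏ τ_i ≥ K^(-m), and `exists_le_prod_balance` bounds ∏ (I_i / |E|) from below, which is
the estimate.

For sharpness, put p = n - 1 and let f_1 be N^m times the indicator of the unit cube, the other f_i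
being that indicator, with N comparable to 2^(pq). The level set contains q^p disjoint boxes of
volume 2^(pq), while Φ^(k)(N^m) is at most a constant times N^m q^(pk). Comparing m-th powers gives
q^(pm) ≤ Q q^(pk) with Q independent of q, which fails for k < m and large q. -/

/-! ### The one-dimensional weak-type bound -/

/-- The one-dimensional maximal function over open intervals with rational end points. -/
noncomputable def ratMaximal (h : ℝ → ℝ≥0∞) (s : ℝ) : ℝ≥0∞ :=
  ⨆ q : ℚ × ℚ, (Ioo (q.1 : ℝ) q.2).indicator
    (fun _ => (∫⁻ r in Ioo (q.1 : ℝ) q.2, h r) / ENNReal.ofReal (q.2 - q.1)) s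

theorem lt_ratMaximal_iff {h : ℝ → ℝ≥0∞} {s : ℝ} {t : ℝ≥0∞} :
    t < ratMaximal h s ↔ ∃ q : ℚ × ℚ, s ∈ Ioo (q.1 : ℝ) q.2 ∧
      t < (∫⁻ r in Ioo (q.1 : ℝ) q.2, h r) / ENNReal.ofReal (q.2 - q.1) := by
  rw [ratMaximal, lt_iSup_iff]
  refine exists_congr fun q => ?_
  by_cases hs : s ∈ Ioo (q.1 : ℝ) q.2 <;> simp [hs]

/-- Vitali's covering lemma: the level set is covered by fivefold enlargements of disjoint intervals
whose averages are at least t. -/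
theorem volume_ratMaximal_le (h : ℝ → ℝ≥0∞) {t : ℝ≥0∞} (ht : t ≠ 0) (ht' : t ≠ ∞) :
    volume {s | t < ratMaximal h s} ≤ 5 / t * ∫⁻ r, h r := by
  by_cases hI : ∫⁻ r, h r = ∞
  · rw [hI, ENNReal.mul_top (by simp [ht'])]
    exact le_top
  set T : Set (ℚ × ℚ) := {q | (q.1 : ℝ) < q.2 ∧
    t * ENNReal.ofReal (q.2 - q.1) ≤ ∫⁻ r in Ioo (q.1 : ℝ) q.2, h r} with hT
  -- Finiteness of the integral bounds the radii, as the Vitali selection requires.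
  have hb : ∀ q ∈ T, ((q.2 : ℝ) - q.1) / 2 ≤ ((∫⁻ r, h r) / t).toReal := by
    intro q hq
    have h1 : ENNReal.ofReal ((q.2 : ℝ) - q.1) ≤ (∫⁻ r, h r) / t := by
      rw [ENNReal.le_div_iff_mul_le (Or.inl ht) (Or.inl ht'), mul_comm]
      exact hq.2.trans (setLIntegral_le_lintegral _ _)
    have h2 := (ENNReal.ofReal_le_iff_le_toReal (ENNReal.div_ne_top hI ht)).1 h1
    have := hq.1
    linarith
  obtain ⟨u, huT, hdisj, hcov⟩ := Vitali.exists_disjoint_subfamily_covering_enlargement_closedBall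
    T (fun q => ((q.1 : ℝ) + q.2) / 2) (fun q => ((q.2 : ℝ) - q.1) / 2) _ hb 5 (by norm_num)
  have hball : ∀ q : ℚ × ℚ, Metric.closedBall (((q.1 : ℝ) + q.2) / 2) (((q.2 : ℝ) - q.1) / 2)
      = Icc (q.1 : ℝ) q.2 := by
    intro q
    rw [Real.closedBall_eq_Icc]
    congr 1 <;> ring
  have hsub : {s | t < ratMaximal h s} ⊆ ⋃ q : u,
      Metric.closedBall (((q.1.1 : ℝ) + q.1.2) / 2) (5 * (((q.1.2 : ℝ) - q.1.1) / 2)) := by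
    intro s hs
    obtain ⟨q, hq, hlt⟩ := lt_ratMaximal_iff.1 hs
    have hq12 : (q.1 : ℝ) < q.2 := hq.1.trans hq.2
    have hqT : q ∈ T := by
      refine ⟨hq12, ?_⟩
      rw [← ENNReal.le_div_iff_mul_le (Or.inl ?_) (Or.inl ENNReal.ofReal_ne_top)]
      · exact hlt.le
      · simpa using hq12
    obtain ⟨b, hbu, hsubb⟩ := hcov q hqT
    refine mem_iUnion.2 ⟨⟨b, hbu⟩, hsubb ?_⟩
    rw [hball]
    exact Ioo_subset_Icc_self hq
  calc volume {s | t < ratMaximal h s}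
      ≤ ∑' q : u, volume (Metric.closedBall (((q.1.1 : ℝ) + q.1.2) / 2)
          (5 * (((q.1.2 : ℝ) - q.1.1) / 2))) := (measure_mono hsub).trans (measure_iUnion_le _)
    _ ≤ ∑' q : u, 5 / t * ∫⁻ r in Ioo (q.1.1 : ℝ) q.1.2, h r := by
        refine ENNReal.tsum_le_tsum fun q => ?_
        obtain ⟨h1, h2⟩ := huT q.2
        rw [Real.volume_closedBall, show 2 * (5 * (((q.1.2 : ℝ) - q.1.1) / 2))
          = 5 * ((q.1.2 : ℝ) - q.1.1) by ring, ENNReal.ofReal_mul (by norm_num),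
          ENNReal.ofReal_ofNat, div_eq_mul_inv, mul_assoc]
        gcongr
        rw [mul_comm, ← div_eq_mul_inv, ENNReal.le_div_iff_mul_le (Or.inl ht) (Or.inl ht'),
          mul_comm]
        exact h2
    _ = 5 / t * ∫⁻ r in ⋃ q : u, Ioo (q.1.1 : ℝ) q.1.2, h r := by
        rw [ENNReal.tsum_mul_left, lintegral_iUnion (fun _ => measurableSet_Ioo)]
        intro a b hab
        have := hdisj a.2 b.2 (Subtype.coe_injective.ne hab)
        simp only [Function.onFun, hball] at this ⊢
        exact this.mono Ioo_subset_Icc_self Ioo_subset_Icc_self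
    _ ≤ 5 / t * ∫⁻ r, h r := by
        gcongr
        exact Measure.restrict_le_self

/-- The part of h below t contributes at most t to any average, so the part above t must still have
an average exceeding t. -/
theorem volume_ratMaximal_le_setLIntegral {h : ℝ → ℝ≥0∞} (hm : Measurable h) {t : ℝ≥0∞}
    (ht : t ≠ 0) (ht' : t ≠ ∞) :
    volume {s | 2 * t < ratMaximal h s} ≤ 5 / t * ∫⁻ r in {r | t < h r}, h r := by
  have hms : MeasurableSet {r | t < h r} := measurableSet_lt measurable_const hm
  rw [← lintegral_indicator hms]
  refine le_trans (measure_mono fun s hs => ?_) (volume_ratMaximal_le _ ht ht')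
  obtain ⟨q, hq, hlt⟩ := lt_ratMaximal_iff.1 hs
  refine lt_ratMaximal_iff.2 ⟨q, hq, ?_⟩
  have hq12 : 0 < (q.2 : ℝ) - q.1 := sub_pos.2 (hq.1.trans hq.2)
  have h0 : ENNReal.ofReal ((q.2 : ℝ) - q.1) ≠ 0 := by simpa using hq12
  have hle : (∫⁻ r in Ioo (q.1 : ℝ) q.2, h r) / ENNReal.ofReal (q.2 - q.1) ≤
      (∫⁻ r in Ioo (q.1 : ℝ) q.2, {r | t < h r}.indicator h r) / ENNReal.ofReal (q.2 - q.1)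
        + t := by
    have : ∫⁻ r in Ioo (q.1 : ℝ) q.2, h r ≤
        ∫⁻ r in Ioo (q.1 : ℝ) q.2, ({r | t < h r}.indicator h r + t) := by
      refine lintegral_mono fun r => ?_
      by_cases hr : t < h r
      · simp [hr]
      · simpa [hr] using not_lt.1 hr
    rw [lintegral_add_right _ measurable_const, setLIntegral_const, Real.volume_Ioo] at this
    refine (ENNReal.div_le_div_right this _).trans ?_
    rw [ENNReal.add_div, ENNReal.mul_div_cancel_right h0 ENNReal.ofReal_ne_top]
  rw [two_mul] at hlt
  exact (ENNReal.add_lt_add_iff_right ht').1 (hlt.trans_le hle)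

/-! ### Iterated maximal functions: measurability and slicing -/

/-- `f ↦ M₀ M₁ ⋯ Mₙ₋₁ f`, with `Mⱼ` the maximal function over rational intervals in the `j`-th
variable. -/
noncomputable def iterMaximal : (n : ℕ) → ((Fin n → ℝ) → ℝ≥0∞) → (Fin n → ℝ) → ℝ≥0∞
  | 0, f, x => f x
  | n + 1, f, x =>
    ratMaximal (fun r => iterMaximal n (fun y => f (Fin.cons r y)) (Fin.tail x)) (x 0)

theorem measurable_fin_cons {n : ℕ} {Y : Type} [MeasurableSpace Y] {a : Y → ℝ}
    {b : Y → Fin n → ℝ} (ha : Measurable a) (hb : Measurable b) :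
    Measurable fun y => (Fin.cons (a y) (b y) : Fin (n + 1) → ℝ) := by
  rw [measurable_pi_iff]
  intro i
  refine Fin.cases ?_ (fun j => ?_) i
  · simpa using ha
  · simpa [Function.comp_def] using (measurable_pi_apply j).comp hb

theorem measurable_ratMaximal {Y : Type} [MeasurableSpace Y] {g : Y → ℝ → ℝ≥0∞}
    (hg : Measurable (Function.uncurry g)) {a : Y → ℝ} (ha : Measurable a) :
    Measurable fun y => ratMaximal (g y) (a y) := by
  refine Measurable.iSup fun q => ?_
  have h1 : Measurable fun y => (∫⁻ r in Ioo (q.1 : ℝ) q.2, g y r)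
      / ENNReal.ofReal ((q.2 : ℝ) - q.1) :=
    (Measurable.lintegral_prod_right' (ν := volume.restrict (Ioo (q.1 : ℝ) q.2)) hg).div_const _
  exact h1.indicator (ha measurableSet_Ioo)

/-- The parameter space makes the induction close: slicing off a variable adds it to the parameters,
replacing Y by Y × ℝ. -/
theorem measurable_iterMaximal_param (n : ℕ) : ∀ {Y : Type} [MeasurableSpace Y]
    {g : Y → (Fin n → ℝ) → ℝ≥0∞} (_ : Measurable (Function.uncurry g)) {b : Y → Fin n → ℝ}
    (_ : Measurable b), Measurable fun y => iterMaximal n (g y) (b y) := by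
  induction n with
  | zero =>
    intro Y _ g hg b hb
    exact hg.comp (measurable_id.prodMk hb)
  | succ n ih =>
    intro Y _ g hg b hb
    refine measurable_ratMaximal ?_ ((measurable_pi_apply 0).comp hb)
    refine ih (Y := Y × ℝ) (g := fun p y => g p.1 (Fin.cons p.2 y)) ?_
      (b := fun p => Fin.tail (b p.1)) ?_
    · exact hg.comp ((measurable_fst.comp measurable_fst).prodMk
        (measurable_fin_cons (measurable_snd.comp measurable_fst) measurable_snd))
    · rw [measurable_pi_iff]
      exact fun i => (measurable_pi_apply i.succ).comp (hb.comp measurable_fst)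

theorem measurable_iterMaximal {n : ℕ} {f : (Fin n → ℝ) → ℝ≥0∞} (hf : Measurable f) :
    Measurable (iterMaximal n f) :=
  measurable_iterMaximal_param n (Y := Fin n → ℝ) (g := fun _ => f) (hf.comp measurable_snd)
    measurable_id

theorem measurable_iterMaximal_cons {n : ℕ} {f : (Fin (n + 1) → ℝ) → ℝ≥0∞} (hf : Measurable f) :
    Measurable fun p : ℝ × (Fin n → ℝ) =>
      iterMaximal n (fun y => f (Fin.cons p.1 y)) p.2 :=
  measurable_iterMaximal_param n (Y := ℝ × (Fin n → ℝ)) (g := fun p y => f (Fin.cons p.1 y))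
    (hf.comp (measurable_fin_cons (measurable_fst.comp measurable_fst) measurable_snd))
    measurable_snd

theorem lintegral_fin_succ {n : ℕ} {F : (Fin (n + 1) → ℝ) → ℝ≥0∞} (hF : Measurable F) :
    ∫⁻ x, F x = ∫⁻ r : ℝ, ∫⁻ y : Fin n → ℝ, F (Fin.cons r y) := by
  have h := (volume_preserving_piFinSuccAbove (fun _ : Fin (n + 1) => ℝ) 0).symm
  rw [← h.lintegral_comp hF]
  have hm : Measurable fun p : ℝ × (Fin n → ℝ) =>
      F ((MeasurableEquiv.piFinSuccAbove (fun _ => ℝ) 0).symm p) := hF.comp h.measurable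
  rw [Measure.volume_eq_prod, lintegral_prod _ hm.aemeasurable]
  simp [MeasurableEquiv.piFinSuccAbove, Fin.insertNthEquiv]

theorem lintegral_fin_succ_swap {n : ℕ} {F : (Fin (n + 1) → ℝ) → ℝ≥0∞} (hF : Measurable F) :
    ∫⁻ x, F x = ∫⁻ y : Fin n → ℝ, ∫⁻ r : ℝ, F (Fin.cons r y) := by
  rw [lintegral_fin_succ hF, lintegral_lintegral_swap]
  exact (hF.comp (measurable_fin_cons measurable_fst measurable_snd)).aemeasurable

/-! ### Weak-type bound for the iterated maximal function -/

/-- The number of `k ≥ 0` with `2 ^ k * t < u`. -/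
noncomputable def dyadicCount (t u : ℝ≥0∞) : ℝ≥0∞ := ∑' k : ℕ, if 2 ^ k * t < u then 1 else 0

/-- `u N(t,u) ^ n` for `t < u`, and zero otherwise: a dyadic version of `u (log (u / t)) ^ n`. -/
noncomputable def dyadicLog (n : ℕ) (t u : ℝ≥0∞) : ℝ≥0∞ :=
  if t < u then u * dyadicCount t u ^ n else 0

theorem measurable_dyadicCount (t : ℝ≥0∞) : Measurable (dyadicCount t) :=
  Measurable.tsum fun _ => Measurable.ite measurableSet_Ioi measurable_const measurable_const

theorem measurable_dyadicLog (n : ℕ) (t : ℝ≥0∞) : Measurable (dyadicLog n t) :=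
  Measurable.ite measurableSet_Ioi (measurable_id.mul ((measurable_dyadicCount t).pow_const n))
    measurable_const

theorem le_two_pow_mul (k : ℕ) (t : ℝ≥0∞) : t ≤ 2 ^ k * t :=
  le_mul_of_one_le_left zero_le (one_le_pow₀ (by norm_num))

theorem dyadicCount_two_pow_mul_le (k : ℕ) (t u : ℝ≥0∞) :
    dyadicCount (2 ^ k * t) u ≤ dyadicCount t u := by
  refine ENNReal.tsum_le_tsum fun j => ?_
  by_cases h : 2 ^ j * (2 ^ k * t) < u
  · have : 2 ^ j * t < u := lt_of_le_of_lt (by gcongr; exact le_two_pow_mul k t) h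
    simp [h, this]
  · simp [h]

/-- Exactly `dyadicCount t u` terms are nonzero, each at most `dyadicLog n t u`: this is where a
logarithm is gained. -/
theorem tsum_dyadicLog_le (n : ℕ) (t u : ℝ≥0∞) :
    ∑' k : ℕ, dyadicLog n (2 ^ k * t) u ≤ dyadicLog (n + 1) t u := by
  by_cases htu : t < u
  · have : dyadicLog (n + 1) t u
        = ∑' k : ℕ, u * dyadicCount t u ^ n * if 2 ^ k * t < u then 1 else 0 := by
      rw [ENNReal.tsum_mul_left, dyadicLog, if_pos htu, pow_succ, mul_assoc]
      rfl
    rw [this]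
    refine ENNReal.tsum_le_tsum fun k => ?_
    by_cases h : 2 ^ k * t < u
    · simp only [dyadicLog, h, if_true, mul_one]
      gcongr
      exact dyadicCount_two_pow_mul_le k t u
    · simp [dyadicLog, h]
  · have : ∀ k : ℕ, ¬ 2 ^ k * t < u := fun k hk => htu ((le_two_pow_mul k t).trans_lt hk)
    simp [dyadicLog, this]

/-- A dyadic layer-cake estimate. -/
theorem indicator_lt_le_tsum {t : ℝ≥0∞} (ht : t ≠ 0) (g : ℝ≥0∞) :
    (if t < g then g else 0) ≤ ∑' k : ℕ, 2 ^ (k + 1) * t * if 2 ^ k * t < g then 1 else 0 := by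
  by_cases htg : t < g
  · rw [if_pos htg]
    by_cases hall : ∀ k : ℕ, 2 ^ k * t < g
    · have : ∑' k : ℕ, 2 ^ (k + 1) * t * (if 2 ^ k * t < g then 1 else 0) = ∞ := by
        refine top_unique ?_
        rw [← ENNReal.tsum_const_eq_top_of_ne_zero (α := ℕ) ht]
        refine ENNReal.tsum_le_tsum fun k => ?_
        simpa [hall k] using le_two_pow_mul (k + 1) t
      rw [this]
      exact le_top
    · push Not at hall
      classical
      obtain ⟨k, hk⟩ : ∃ k, Nat.find hall = k + 1 := by
        refine Nat.exists_eq_succ_of_ne_zero fun h0 => ?_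
        have := Nat.find_spec hall
        rw [h0] at this
        simp only [pow_zero, one_mul] at this
        exact absurd htg this.not_gt
      have h1 : g ≤ 2 ^ (k + 1) * t := hk ▸ Nat.find_spec hall
      have h2 : 2 ^ k * t < g := not_le.1 (Nat.find_min hall (m := k) (by omega))
      refine le_trans ?_ (ENNReal.le_tsum k)
      simpa [h2] using h1
  · simp [htg]

/-- The truncated weak bound is applied in the first variable with the others fixed; after Fubini,
`hC` handles the remaining variables on each slice. -/
theorem volume_iterMaximal_succ_le {n : ℕ} {C : ℝ≥0∞} {t : ℝ≥0∞} (ht : t ≠ 0) (ht' : t ≠ ∞)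
    (hC : ∀ f : (Fin n → ℝ) → ℝ≥0∞, Measurable f →
      ∫⁻ x in {x | 2 ^ n * t < iterMaximal n f x}, iterMaximal n f x ≤
        C * ∫⁻ x, dyadicLog n t (f x))
    {f : (Fin (n + 1) → ℝ) → ℝ≥0∞} (hf : Measurable f) :
    volume {x | 2 ^ (n + 1) * t < iterMaximal (n + 1) f x} ≤
      5 / t * C * ∫⁻ x, dyadicLog n t (f x) := by
  have hmT := measurable_iterMaximal hf
  have hms : MeasurableSet {x | 2 ^ (n + 1) * t < iterMaximal (n + 1) f x} :=
    measurableSet_lt measurable_const hmT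
  set g : ℝ → (Fin n → ℝ) → ℝ≥0∞ := fun r y => iterMaximal n (fun z => f (Fin.cons r z)) y with hg
  have hgm : Measurable (fun p : ℝ × (Fin n → ℝ) => g p.1 p.2) := measurable_iterMaximal_cons hf
  have h2t : 2 ^ n * t ≠ 0 := by simp [ht]
  have h2t' : 2 ^ n * t ≠ ∞ := ENNReal.mul_ne_top (by simp) ht'
  have hF : Measurable fun p : ℝ × (Fin n → ℝ) =>
      {p : ℝ × (Fin n → ℝ) | 2 ^ n * t < g p.1 p.2}.indicator (fun p => g p.1 p.2) p :=
    hgm.indicator (measurableSet_lt measurable_const hgm)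
  have hdl : Measurable fun x => dyadicLog n t (f x) := (measurable_dyadicLog n t).comp hf
  calc volume {x | 2 ^ (n + 1) * t < iterMaximal (n + 1) f x}
      = ∫⁻ y : Fin n → ℝ, volume {r : ℝ | 2 * (2 ^ n * t) < ratMaximal (fun r => g r y) r} := by
        rw [← lintegral_indicator_one hms,
          lintegral_fin_succ_swap (measurable_one.indicator hms)]
        refine lintegral_congr fun y => ?_
        have hms2 : MeasurableSet {r : ℝ | 2 * (2 ^ n * t) < ratMaximal (fun r => g r y) r} := by
          refine measurableSet_lt measurable_const (measurable_ratMaximal (Y := ℝ)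
            (g := fun _ r => g r y) ?_ measurable_id)
          exact hgm.comp (measurable_snd.prodMk measurable_const)
        rw [← lintegral_indicator_one hms2]
        refine lintegral_congr fun r => ?_
        simp only [indicator_apply, mem_ofPred_eq, iterMaximal, Fin.tail_cons, Fin.cons_zero, hg,
          pow_succ', mul_assoc, Pi.one_apply]
    _ ≤ ∫⁻ y : Fin n → ℝ, 5 / t * ∫⁻ r : ℝ,
          {p : ℝ × (Fin n → ℝ) | 2 ^ n * t < g p.1 p.2}.indicator (fun p => g p.1 p.2) (r, y) := by
        refine lintegral_mono fun y => ?_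
        have hgy : Measurable fun r => g r y := hgm.comp (measurable_id.prodMk measurable_const)
        refine (volume_ratMaximal_le_setLIntegral hgy h2t h2t').trans ?_
        rw [← lintegral_indicator (measurableSet_lt measurable_const hgy)]
        refine mul_le_mul' (ENNReal.div_le_div_left (le_two_pow_mul n t) _) (le_of_eq ?_)
        rfl
    _ = 5 / t * ∫⁻ r : ℝ, ∫⁻ y : Fin n → ℝ,
          {p : ℝ × (Fin n → ℝ) | 2 ^ n * t < g p.1 p.2}.indicator (fun p => g p.1 p.2) (r, y) := by
        rw [lintegral_const_mul' _ _ (ENNReal.div_ne_top (by simp) ht),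
          lintegral_lintegral_swap]
        exact (hF.comp measurable_swap).aemeasurable
    _ ≤ 5 / t * ∫⁻ r : ℝ, C * ∫⁻ y : Fin n → ℝ, dyadicLog n t (f (Fin.cons r y)) := by
        gcongr with r
        have hgr : Measurable fun y => g r y := hgm.comp (measurable_const.prodMk measurable_id)
        refine le_trans (le_of_eq ?_)
          (hC (fun y => f (Fin.cons r y)) (hf.comp (measurable_fin_cons measurable_const
            measurable_id)))
        rw [← lintegral_indicator (measurableSet_lt measurable_const hgr)]
        rfl
    _ = 5 / t * C * ∫⁻ x, dyadicLog n t (f x) := by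
        rw [lintegral_const_mul, ← lintegral_fin_succ hdl, mul_assoc]
        exact Measurable.lintegral_prod_right' (f := fun p : ℝ × (Fin n → ℝ) =>
          dyadicLog n t (f (Fin.cons p.1 p.2)))
          (hdl.comp (measurable_fin_cons measurable_fst measurable_snd))

/-- The integral over the level set is split into dyadic levels. In the weak bound at level 2^k t,
the factor 1/(2^k t) cancels the height, and `tsum_dyadicLog_le` sums what is left. -/
theorem setLIntegral_iterMaximal_le (n : ℕ) : ∃ C : ℝ≥0∞, C ≠ ∞ ∧ ∀ t : ℝ≥0∞, t ≠ 0 → t ≠ ∞ →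
    ∀ f : (Fin n → ℝ) → ℝ≥0∞, Measurable f →
      ∫⁻ x in {x | 2 ^ n * t < iterMaximal n f x}, iterMaximal n f x ≤
        C * ∫⁻ x, dyadicLog n t (f x) := by
  induction n with
  | zero =>
    refine ⟨1, by simp, fun t ht ht' f hf => ?_⟩
    rw [← lintegral_indicator (measurableSet_lt measurable_const (measurable_iterMaximal hf)),
      one_mul]
    refine lintegral_mono fun x => ?_
    simp only [indicator_apply, mem_ofPred_eq, iterMaximal, dyadicLog, pow_zero, one_mul, mul_one]
    exact le_rfl
  | succ n ih =>
    obtain ⟨C, hC, h⟩ := ih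
    refine ⟨2 ^ (n + 2) * 5 * C, ENNReal.mul_ne_top (by finiteness) hC, fun t ht ht' f hf => ?_⟩
    have hmT := measurable_iterMaximal hf
    have hmi : ∀ k : ℕ, MeasurableSet {x | 2 ^ k * (2 ^ (n + 1) * t) < iterMaximal (n + 1) f x} :=
      fun k => measurableSet_lt measurable_const hmT
    rw [← lintegral_indicator (measurableSet_lt measurable_const hmT)]
    calc ∫⁻ x, {x | 2 ^ (n + 1) * t < iterMaximal (n + 1) f x}.indicator (iterMaximal (n + 1) f) x
        ≤ ∫⁻ x, ∑' k : ℕ, 2 ^ (k + 1) * (2 ^ (n + 1) * t) *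
          {x | 2 ^ k * (2 ^ (n + 1) * t) < iterMaximal (n + 1) f x}.indicator 1 x := by
          refine lintegral_mono fun x => ?_
          have := indicator_lt_le_tsum (t := 2 ^ (n + 1) * t) (by simp [ht])
            (iterMaximal (n + 1) f x)
          simpa only [indicator_apply, mem_ofPred_eq, Pi.one_apply] using this
      _ = ∑' k : ℕ, 2 ^ (k + 1) * (2 ^ (n + 1) * t) *
          volume {x | 2 ^ (n + 1) * (2 ^ k * t) < iterMaximal (n + 1) f x} := by
          rw [lintegral_tsum fun k =>
            ((measurable_one.indicator (hmi k)).const_mul _).aemeasurable]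
          refine tsum_congr fun k => ?_
          rw [lintegral_const_mul _ (measurable_one.indicator (hmi k)),
            lintegral_indicator_one (hmi k), mul_left_comm (2 ^ k) (2 ^ (n + 1)) t]
      _ ≤ ∑' k : ℕ, 2 ^ (k + 1) * (2 ^ (n + 1) * t) *
          (5 / (2 ^ k * t) * C * ∫⁻ x, dyadicLog n (2 ^ k * t) (f x)) := by
          refine ENNReal.tsum_le_tsum fun k => ?_
          have h0 : 2 ^ k * t ≠ 0 := by simp [ht]
          have h1 : 2 ^ k * t ≠ ∞ := ENNReal.mul_ne_top (by simp) ht'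
          gcongr
          exact volume_iterMaximal_succ_le h0 h1 (fun f hf => h _ h0 h1 f hf) hf
      _ = ∑' k : ℕ, 2 ^ (n + 2) * 5 * C * ∫⁻ x, dyadicLog n (2 ^ k * t) (f x) := by
          refine tsum_congr fun k => ?_
          have h0 : 2 ^ k * t ≠ 0 := by simp [ht]
          have h1 : 2 ^ k * t ≠ ∞ := ENNReal.mul_ne_top (by simp) ht'
          rw [← mul_assoc, ← mul_assoc]
          congr 2
          rw [show (2 : ℝ≥0∞) ^ (k + 1) * (2 ^ (n + 1) * t) = 2 ^ (n + 2) * (2 ^ k * t) by ring,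
            mul_assoc, ENNReal.mul_div_cancel h0 h1]
      _ ≤ 2 ^ (n + 2) * 5 * C * ∫⁻ x, dyadicLog (n + 1) t (f x) := by
          have hm : ∀ k : ℕ, AEMeasurable fun x => dyadicLog n (2 ^ k * t) (f x) := fun k =>
            ((measurable_dyadicLog n _).comp hf).aemeasurable
          rw [ENNReal.tsum_mul_left, ← lintegral_tsum hm]
          gcongr with x
          exact tsum_dyadicLog_le n t (f x)

theorem volume_iterMaximal_le (n : ℕ) : ∃ C : ℝ≥0∞, C ≠ ∞ ∧ ∀ t : ℝ≥0∞, t ≠ 0 → t ≠ ∞ →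
    ∀ f : (Fin (n + 1) → ℝ) → ℝ≥0∞, Measurable f →
      volume {x | 2 ^ (n + 1) * t < iterMaximal (n + 1) f x} ≤
        C / t * ∫⁻ x, dyadicLog n t (f x) := by
  obtain ⟨C, hC, h⟩ := setLIntegral_iterMaximal_le n
  refine ⟨5 * C, by finiteness, fun t ht ht' f hf => ?_⟩
  have := volume_iterMaximal_succ_le ht ht' (h t ht ht') hf
  rwa [ENNReal.mul_div_right_comm]

/-! ### Rectangle averages against iterated maximal functions -/

theorem setLIntegral_Ioo_le_ratMaximal (g : ℝ → ℝ≥0∞) {a b s : ℝ} (hs : s ∈ Ioo a b) :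
    ∫⁻ r in Ioo a b, g r ≤ 2 * ENNReal.ofReal (b - a) * ratMaximal g s := by
  have hab : a < b := hs.1.trans hs.2
  -- Extending by less than half the length on each side keeps the rational interval shorter than 2
  -- (b - a).
  obtain ⟨a', ha1, ha2⟩ := exists_rat_btwn (show a - (b - a) / 2 < a by linarith)
  obtain ⟨b', hb1, hb2⟩ := exists_rat_btwn (show b < b + (b - a) / 2 by linarith)
  have hlen : (0 : ℝ) < b' - a' := by linarith
  have h1 : (∫⁻ r in Ioo (a' : ℝ) b', g r) / ENNReal.ofReal (b' - a') ≤ ratMaximal g s := by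
    refine le_iSup_of_le (a', b') ?_
    rw [indicator_of_mem]
    exact ⟨ha2.trans hs.1, hs.2.trans hb1⟩
  rw [ENNReal.div_le_iff (by simpa using hlen) ENNReal.ofReal_ne_top] at h1
  calc ∫⁻ r in Ioo a b, g r ≤ ∫⁻ r in Ioo (a' : ℝ) b', g r :=
        lintegral_mono_set (Ioo_subset_Ioo ha2.le hb1.le)
    _ ≤ ratMaximal g s * ENNReal.ofReal (b' - a') := h1
    _ ≤ ratMaximal g s * ENNReal.ofReal (2 * (b - a)) := by
        gcongr
        linarith
    _ = _ := by
        rw [ENNReal.ofReal_mul (by norm_num), ENNReal.ofReal_ofNat, mul_comm]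

theorem setLIntegral_pi_Ioo_le_iterMaximal (n : ℕ) : ∀ {f : (Fin n → ℝ) → ℝ≥0∞}
    (_ : Measurable f) {a b x : Fin n → ℝ} (_ : ∀ i, x i ∈ Ioo (a i) (b i)),
    ∫⁻ y in univ.pi fun i => Ioo (a i) (b i), f y ≤
      2 ^ n * (∏ i, ENNReal.ofReal (b i - a i)) * iterMaximal n f x := by
  induction n with
  | zero =>
    intro f hf a b x hx
    rw [Measure.volume_pi_eq_dirac x]
    refine (setLIntegral_le_lintegral _ _).trans ?_
    simp [iterMaximal, lintegral_dirac' _ hf]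
  | succ n ih =>
    intro f hf a b x hx
    have hR : MeasurableSet (univ.pi fun i => Ioo (a i) (b i)) :=
      MeasurableSet.univ_pi fun i => measurableSet_Ioo
    rw [← lintegral_indicator hR, lintegral_fin_succ (hf.indicator hR)]
    set g : ℝ → ℝ≥0∞ := fun r => iterMaximal n (fun y => f (Fin.cons r y)) (Fin.tail x) with hg
    calc ∫⁻ r, ∫⁻ y, (univ.pi fun i => Ioo (a i) (b i)).indicator f (Fin.cons r y)
        ≤ ∫⁻ r in Ioo (a 0) (b 0), 2 ^ n * (∏ i : Fin n, ENNReal.ofReal (b i.succ - a i.succ)) *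
            g r := by
          rw [← lintegral_indicator measurableSet_Ioo]
          refine lintegral_mono fun r => ?_
          by_cases hr : r ∈ Ioo (a 0) (b 0)
          · rw [indicator_of_mem hr]
            refine le_trans (le_of_eq ?_) (ih (f := fun y => f (Fin.cons r y))
              (hf.comp (measurable_fin_cons measurable_const measurable_id))
              (a := fun i => a i.succ) (b := fun i => b i.succ) fun i => hx i.succ)
            rw [← lintegral_indicator (MeasurableSet.univ_pi fun i => measurableSet_Ioo)]
            refine lintegral_congr fun y => ?_
            classical
            rw [indicator_apply, indicator_apply]
            simp only [mem_univ_pi, Fin.forall_fin_succ, Fin.cons_zero, Fin.cons_succ, hr, true_and]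
          · rw [indicator_of_notMem hr]
            refine le_of_eq (lintegral_eq_zero_of_ae_eq_zero (Filter.Eventually.of_forall ?_))
            intro y
            refine indicator_of_notMem (fun h => hr ?_) _
            simpa using h 0 (mem_univ _)
      _ = 2 ^ n * (∏ i : Fin n, ENNReal.ofReal (b i.succ - a i.succ)) *
            ∫⁻ r in Ioo (a 0) (b 0), g r := by
          refine lintegral_const_mul' _ _ (ENNReal.mul_ne_top (by finiteness) ?_)
          exact ENNReal.prod_ne_top fun _ _ => ENNReal.ofReal_ne_top
      _ ≤ 2 ^ n * (∏ i : Fin n, ENNReal.ofReal (b i.succ - a i.succ)) *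
            (2 * ENNReal.ofReal (b 0 - a 0) * ratMaximal g (x 0)) := by
          gcongr
          exact setLIntegral_Ioo_le_ratMaximal g (hx 0)
      _ = 2 ^ (n + 1) * (∏ i, ENNReal.ofReal (b i - a i)) * iterMaximal (n + 1) f x := by
          rw [Fin.prod_univ_succ, iterMaximal, ← hg]
          ring

theorem setLAverage_le_iterMaximal {n : ℕ} {f : (Fin n → ℝ) → ℝ≥0∞} (hf : Measurable f)
    {R : Set (Fin n → ℝ)} (hR : R ∈ openRectangles n) {x : Fin n → ℝ} (hx : x ∈ R) :
    ⨍⁻ y in R, f y ∂volume ≤ 2 ^ n * iterMaximal n f x := by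
  obtain ⟨a, b, hab, rfl⟩ := hR
  rw [setLAverage_eq, Real.volume_pi_Ioo]
  refine ENNReal.div_le_of_le_mul ?_
  rw [mul_right_comm]
  exact setLIntegral_pi_Ioo_le_iterMaximal n hf fun i => hx i (mem_univ i)

/-! ### Growth of Φ and its iterates -/

/-- The factor `1 + (log⁺ t) ^ p` of `Phi (p + 1) t`. -/
noncomputable def logWeight (p : ℕ) (t : ℝ) : ℝ := 1 + (Real.posLog t) ^ p

theorem Phi_eq (n : ℕ) (t : ℝ) : Phi n t = t * logWeight (n - 1) t := rfl

theorem one_le_logWeight (p : ℕ) (t : ℝ) : 1 ≤ logWeight p t :=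
  le_add_of_nonneg_right (pow_nonneg Real.posLog_nonneg p)

theorem logWeight_pos (p : ℕ) (t : ℝ) : 0 < logWeight p t :=
  zero_lt_one.trans_le (one_le_logWeight p t)

theorem continuous_logWeight (p : ℕ) : Continuous (logWeight p) := by
  unfold logWeight
  fun_prop

theorem logWeight_mono {p : ℕ} {s t : ℝ} (hs : 0 ≤ s) (hst : s ≤ t) :
    logWeight p s ≤ logWeight p t := by
  unfold logWeight
  gcongr 1 + ?_ ^ p
  · exact Real.posLog_nonneg
  · exact Real.posLog_le_posLog hs hst

theorem logWeight_le_two {p : ℕ} {t : ℝ} (h0 : 0 ≤ t) (h1 : t ≤ 1) : logWeight p t ≤ 2 := by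
  have h : Real.posLog t = 0 := (Real.posLog_eq_zero_iff t).2 (by rwa [abs_of_nonneg h0])
  have : (0 : ℝ) ^ p ≤ 1 := pow_le_one₀ le_rfl zero_le_one
  rw [logWeight, h]
  linarith

/-- Follows from log⁺(st) ≤ log⁺ s + log⁺ t and convexity of the p-th power. -/
theorem logWeight_mul_le (p : ℕ) (s t : ℝ) :
    logWeight p (s * t) ≤ 2 ^ p * logWeight p s * logWeight p t := by
  have ha := Real.posLog_nonneg (x := s)
  have hb := Real.posLog_nonneg (x := t)
  have h1 : Real.posLog (s * t) ^ p ≤ (Real.posLog s + Real.posLog t) ^ p :=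
    pow_le_pow_left₀ Real.posLog_nonneg Real.posLog_mul p
  have h2 := add_pow_le ha hb p
  have h3 : (2 : ℝ) ^ (p - 1) ≤ 2 ^ p := pow_le_pow_right₀ (by norm_num) (by omega)
  have h4 : (1 : ℝ) ≤ 2 ^ p := one_le_pow₀ (by norm_num)
  have hap := pow_nonneg ha p
  have hbp := pow_nonneg hb p
  have h5 : (2 : ℝ) ^ (p - 1) * (Real.posLog s ^ p + Real.posLog t ^ p)
      ≤ 2 ^ p * (Real.posLog s ^ p + Real.posLog t ^ p) := by gcongr
  have h6 : (0 : ℝ) ≤ 2 ^ p * (Real.posLog s ^ p * Real.posLog t ^ p) := by positivity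
  unfold logWeight
  nlinarith

/-- The leading 2 serves the empty product when p = 0, where the weight is 2. -/
theorem logWeight_prod_le {ι : Type} (p : ℕ) (s : Finset ι) (x : ι → ℝ) :
    logWeight p (∏ i ∈ s, x i) ≤ 2 * ∏ i ∈ s, (2 ^ p * logWeight p (x i)) := by
  classical
  induction s using Finset.induction_on with
  | empty => simpa using logWeight_le_two (p := p) zero_le_one le_rfl
  | insert a s ha ih =>
    rw [Finset.prod_insert ha, Finset.prod_insert ha]
    have h0 : 0 ≤ 2 ^ p * logWeight p (x a) := by have := logWeight_pos p (x a); positivity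
    calc _ ≤ 2 ^ p * logWeight p (x a) * logWeight p (∏ i ∈ s, x i) := logWeight_mul_le _ _ _
      _ ≤ 2 ^ p * logWeight p (x a) * (2 * ∏ i ∈ s, (2 ^ p * logWeight p (x i))) := by gcongr
      _ = _ := by ring

theorem continuous_Phi (n : ℕ) : Continuous (Phi n) :=
  continuous_id.mul (continuous_logWeight (n - 1))

theorem le_Phi {n : ℕ} {t : ℝ} (ht : 0 ≤ t) : t ≤ Phi n t :=
  le_mul_of_one_le_right ht (one_le_logWeight _ t)

theorem Phi_nonneg {n : ℕ} {t : ℝ} (ht : 0 ≤ t) : 0 ≤ Phi n t := ht.trans (le_Phi ht)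

theorem Phi_mono {n : ℕ} {s t : ℝ} (hs : 0 ≤ s) (hst : s ≤ t) : Phi n s ≤ Phi n t :=
  mul_le_mul hst (logWeight_mono hs hst) (logWeight_pos _ _).le (hs.trans hst)

theorem mul_Phi_le {n : ℕ} {c t : ℝ} (hc : 1 ≤ c) (ht : 0 ≤ t) : c * Phi n t ≤ Phi n (c * t) := by
  rw [Phi_eq, Phi_eq, ← mul_assoc]
  exact mul_le_mul_of_nonneg_left (logWeight_mono ht (le_mul_of_one_le_left ht hc)) (by positivity)

theorem Phi_mul_le {n : ℕ} {s t : ℝ} (hs : 0 ≤ s) (ht : 0 ≤ t) :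
    Phi n (s * t) ≤ 2 ^ (n - 1) * (s * logWeight (n - 1) s) * Phi n t := by
  rw [Phi_eq, Phi_eq]
  calc s * t * logWeight (n - 1) (s * t)
      ≤ s * t * (2 ^ (n - 1) * logWeight (n - 1) s * logWeight (n - 1) t) :=
        mul_le_mul_of_nonneg_left (logWeight_mul_le _ _ _) (by positivity)
    _ = _ := by ring

theorem Phi_div_le {n : ℕ} {c t : ℝ} (hc : 1 ≤ c) (ht : 0 ≤ t) : Phi n (t / c) ≤ Phi n t / c := by
  have hc0 : 0 < c := by linarith
  rw [le_div_iff₀ hc0, mul_comm]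
  refine (mul_Phi_le hc (by positivity)).trans_eq ?_
  rw [mul_div_cancel₀ _ hc0.ne']

theorem le_iterate_Phi {n : ℕ} (j : ℕ) {t : ℝ} (ht : 0 ≤ t) : t ≤ (Phi n)^[j] t := by
  induction j generalizing t with
  | zero => exact le_rfl
  | succ j ih => exact (le_Phi ht).trans (ih (Phi_nonneg ht))

theorem iterate_Phi_nonneg {n : ℕ} (j : ℕ) {t : ℝ} (ht : 0 ≤ t) : 0 ≤ (Phi n)^[j] t :=
  ht.trans (le_iterate_Phi j ht)

theorem iterate_Phi_mono {n : ℕ} (j : ℕ) {s t : ℝ} (hs : 0 ≤ s) (hst : s ≤ t) :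
    (Phi n)^[j] s ≤ (Phi n)^[j] t := by
  induction j generalizing s t with
  | zero => exact hst
  | succ j ih => exact ih (Phi_nonneg hs) (Phi_mono hs hst)

theorem mul_iterate_Phi_le {n : ℕ} (j : ℕ) {c t : ℝ} (hc : 1 ≤ c) (ht : 0 ≤ t) :
    c * (Phi n)^[j] t ≤ (Phi n)^[j] (c * t) := by
  induction j generalizing t with
  | zero => exact le_rfl
  | succ j ih =>
    rw [Function.iterate_succ_apply, Function.iterate_succ_apply]
    exact (ih (Phi_nonneg ht)).trans (iterate_Phi_mono j
      (mul_nonneg (by linarith) (Phi_nonneg ht)) (mul_Phi_le hc ht))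

theorem mul_logWeight_pow_le_iterate_Phi {n : ℕ} (j : ℕ) {t : ℝ} (ht : 0 ≤ t) :
    t * logWeight (n - 1) t ^ j ≤ (Phi n)^[j] t := by
  induction j with
  | zero => simp
  | succ j ih =>
    rw [Function.iterate_succ_apply', Phi_eq, pow_succ, ← mul_assoc]
    exact mul_le_mul ih (logWeight_mono ht (le_iterate_Phi j ht)) (logWeight_pos _ _).le
      (iterate_Phi_nonneg j ht)

/-! ### The balancing function -/

/-- The growth function `τ φ(τ) ^ j / φ(1 / τ)`, with `φ = logWeight p`. -/
noncomputable def balance (p j : ℕ) (τ : ℝ) : ℝ := τ * logWeight p τ ^ j / logWeight p τ⁻¹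

theorem balance_pos {p j : ℕ} {τ : ℝ} (hτ : 0 < τ) : 0 < balance p j τ :=
  div_pos (mul_pos hτ (pow_pos (logWeight_pos _ _) _)) (logWeight_pos _ _)

theorem exists_balance_eq (p j : ℕ) {J : ℝ} (hJ : 0 < J) : ∃ τ, 0 < τ ∧ balance p j τ = J := by
  set a : ℝ := min 1 (J / 2 ^ j) with ha
  set b : ℝ := max 1 (2 * J) with hb
  have ha0 : 0 < a := by positivity
  have ha1 : a ≤ 1 := min_le_left _ _
  have hb1 : 1 ≤ b := le_max_left _ _
  have hcont : ContinuousOn (balance p j) (Icc a b) := by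
    refine ContinuousOn.div ?_ ?_ fun _ _ => (logWeight_pos _ _).ne'
    · exact (continuous_id.mul ((continuous_logWeight p).pow j)).continuousOn
    · refine (continuous_logWeight p).comp_continuousOn (continuousOn_inv₀.mono ?_)
      exact fun x hx => (ha0.trans_le hx.1).ne'
  have hlow : balance p j a ≤ J := by
    have h1 : a ≤ J / 2 ^ j := min_le_right _ _
    have h2 : logWeight p a ^ j ≤ 2 ^ j :=
      pow_le_pow_left₀ (logWeight_pos _ _).le (logWeight_le_two ha0.le ha1) j
    calc balance p j a ≤ a * logWeight p a ^ j :=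
          div_le_self (mul_nonneg ha0.le (pow_nonneg (logWeight_pos _ _).le _))
            (one_le_logWeight _ _)
      _ ≤ J / 2 ^ j * 2 ^ j := mul_le_mul h1 h2 (pow_nonneg (logWeight_pos _ _).le _) (by positivity)
      _ = J := by field_simp
  have hhigh : J ≤ balance p j b := by
    have h1 : 2 * J ≤ b := le_max_right _ _
    have hb0 : 0 < b := by linarith
    have h2 : logWeight p b⁻¹ ≤ 2 :=
      logWeight_le_two (by positivity) (inv_le_one_of_one_le₀ hb1)
    have h3 : 1 ≤ logWeight p b ^ j := one_le_pow₀ (one_le_logWeight _ _)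
    rw [balance, le_div_iff₀ (logWeight_pos _ _)]
    nlinarith
  obtain ⟨τ, hτ, h⟩ := intermediate_value_Icc (ha1.trans hb1) hcont ⟨hlow, hhigh⟩
  exact ⟨τ, ha0.trans_le hτ.1, h⟩

/-- For τ ≥ 1, Φ(u/τ) ≤ Φ(u)/τ. If this quotient s is at least 1, then s Φ^(j)(τ) ≤ Φ^(j)(sτ) =
Φ^(j+1)(u), and Φ^(j)(τ) dominates `balance`; otherwise the term 1 suffices. For τ ≤ 1, dilation
costs a multiple of φ(1/τ)/τ, comparable to 1/`balance` because φ(τ) ≤ 2. -/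
theorem Phi_div_le_balance {n j : ℕ} {u τ : ℝ} (hu : 0 ≤ u) (hτ : 0 < τ) :
    Phi n (u / τ) ≤ 1 + 2 ^ (n - 1 + j) * ((Phi n)^[j + 1] u / balance (n - 1) j τ) := by
  have hG := balance_pos (p := n - 1) (j := j) hτ
  have hΦ := Phi_nonneg (n := n) hu
  have hΨ := iterate_Phi_nonneg (n := n) (j + 1) hu
  have h2 : (1 : ℝ) ≤ 2 ^ (n - 1 + j) := one_le_pow₀ (by norm_num)
  have hq : 0 ≤ (Phi n)^[j + 1] u / balance (n - 1) j τ := by positivity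
  rcases le_total 1 τ with h1 | h1
  · refine (Phi_div_le h1 hu).trans ?_
    rcases le_total (Phi n u) τ with h | h
    · have : Phi n u / τ ≤ 1 := (div_le_one hτ).2 h
      nlinarith
    · have hs : 1 ≤ Phi n u / τ := (one_le_div hτ).2 h
      have h3 := mul_iterate_Phi_le (n := n) j hs hτ.le
      rw [div_mul_cancel₀ _ hτ.ne', ← Function.iterate_succ_apply] at h3
      have h4 : balance (n - 1) j τ ≤ (Phi n)^[j] τ :=
        (div_le_self (mul_nonneg hτ.le (pow_nonneg (logWeight_pos _ _).le _))
          (one_le_logWeight _ _)).trans (mul_logWeight_pow_le_iterate_Phi j hτ.le)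
      have h5 : Phi n u / τ ≤ (Phi n)^[j + 1] u / balance (n - 1) j τ := by
        rw [le_div_iff₀ hG]
        exact (mul_le_mul_of_nonneg_left h4 (by positivity)).trans h3
      nlinarith
  · have h3 : Phi n (u / τ) ≤ 2 ^ (n - 1) * (τ⁻¹ * logWeight (n - 1) τ⁻¹) * Phi n u := by
      rw [div_eq_inv_mul]
      exact Phi_mul_le (by positivity) hu
    have h4 : logWeight (n - 1) τ ^ j ≤ 2 ^ j :=
      pow_le_pow_left₀ (logWeight_pos _ _).le (logWeight_le_two hτ.le h1) j
    have h5 : Phi n u ≤ (Phi n)^[j + 1] u := le_iterate_Phi j hΦ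
    have h6 : τ⁻¹ * logWeight (n - 1) τ⁻¹ ≤ 2 ^ j / balance (n - 1) j τ := by
      have hw := logWeight_pos (n - 1) τ⁻¹
      have h7 : τ⁻¹ * logWeight (n - 1) τ⁻¹ * balance (n - 1) j τ = logWeight (n - 1) τ ^ j := by
        rw [balance]
        generalize logWeight (n - 1) τ⁻¹ = w at hw ⊢
        field_simp
      rw [le_div_iff₀ hG, h7]
      exact h4
    calc Phi n (u / τ) ≤ 2 ^ (n - 1) * (2 ^ j / balance (n - 1) j τ) * (Phi n)^[j + 1] u := by
          refine h3.trans ?_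
          gcongr
      _ = 2 ^ (n - 1 + j) * ((Phi n)^[j + 1] u / balance (n - 1) j τ) := by
          rw [pow_add]; ring
      _ ≤ _ := by linarith

/-- Since 1/τ_i ≤ κ⁻¹ ∏_{l≠i} τ_l, φ(1/τ_i) is bounded by a multiple of ∏_{l≠i} φ(τ_l). In the
product over i each φ(τ_l) occurs j times, matching the power j in the numerator of `balance`. -/
theorem exists_le_prod_balance (p j : ℕ) {κ : ℝ} (hκ : 0 < κ) : ∃ c : ℝ, 0 < c ∧
    ∀ τ : Fin (j + 1) → ℝ, (∀ i, 0 < τ i) → κ ≤ ∏ i, τ i → c ≤ ∏ i, balance p j (τ i) := by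
  set D : ℝ := 2 ^ p * logWeight p κ⁻¹ * (2 * (2 ^ p) ^ j) with hD
  have hD0 : 0 < D := by have := logWeight_pos p κ⁻¹; positivity
  refine ⟨κ / D ^ (j + 1), by positivity, fun τ hτ hprod => ?_⟩
  set P : ℝ := ∏ i, logWeight p (τ i) with hP
  have hP0 : 0 < P := Finset.prod_pos fun i _ => logWeight_pos _ _
  have h1 : ∀ i, logWeight p (τ i)⁻¹ * logWeight p (τ i) ≤ D * P := by
    intro i
    have hle : (τ i)⁻¹ ≤ κ⁻¹ * ∏ l ∈ Finset.univ.erase i, τ l := by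
      rw [← Finset.mul_prod_erase _ _ (Finset.mem_univ i)] at hprod
      rw [inv_mul_eq_div, le_div_iff₀ hκ, inv_mul_eq_div, div_le_iff₀ (hτ i), mul_comm]
      exact hprod
    have h2 : logWeight p (τ i)⁻¹ ≤ D * ∏ l ∈ Finset.univ.erase i, logWeight p (τ l) := by
      refine (logWeight_mono (inv_nonneg.2 (hτ i).le) hle).trans ((logWeight_mul_le _ _ _).trans ?_)
      have h3 := logWeight_prod_le p (Finset.univ.erase i) τ
      rw [Finset.prod_mul_distrib, Finset.prod_const, Finset.card_erase_of_mem (Finset.mem_univ i),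
        Finset.card_univ, Fintype.card_fin, Nat.add_sub_cancel] at h3
      have h4 : 0 ≤ 2 ^ p * logWeight p κ⁻¹ := by have := logWeight_pos p κ⁻¹; positivity
      calc _ ≤ _ := mul_le_mul_of_nonneg_left h3 h4
        _ = _ := by rw [hD]; ring
    calc _ ≤ (D * ∏ l ∈ Finset.univ.erase i, logWeight p (τ l)) * logWeight p (τ i) :=
          mul_le_mul_of_nonneg_right h2 (logWeight_pos _ _).le
      _ = D * P := by
          rw [hP, ← Finset.mul_prod_erase _ _ (Finset.mem_univ i)]; ring
  have h2 : (∏ i, logWeight p (τ i)⁻¹) * P ≤ (D * P) ^ (j + 1) := by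
    rw [hP, ← Finset.prod_mul_distrib]
    refine (Finset.prod_le_prod (fun i _ => (mul_pos (logWeight_pos _ _)
      (logWeight_pos _ _)).le) fun i _ => h1 i).trans_eq ?_
    simp [hP]
  have h3 : ∏ i, logWeight p (τ i)⁻¹ ≤ D ^ (j + 1) * P ^ j := by
    refine le_of_mul_le_mul_right ?_ hP0
    calc _ ≤ _ := h2
      _ = _ := by ring
  have hQ : 0 < ∏ i, logWeight p (τ i)⁻¹ := Finset.prod_pos fun i _ => logWeight_pos _ _
  have h4 : ∏ i, balance p j (τ i) = (∏ i, τ i) * P ^ j / ∏ i, logWeight p (τ i)⁻¹ := by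
    simp only [balance]
    rw [Finset.prod_div_distrib, Finset.prod_mul_distrib, Finset.prod_pow]
  rw [h4, div_le_div_iff₀ (by positivity) hQ]
  calc κ * ∏ i, logWeight p (τ i)⁻¹ ≤ (∏ i, τ i) * (D ^ (j + 1) * P ^ j) :=
        mul_le_mul hprod h3 hQ.le (hκ.le.trans hprod)
    _ = _ := by ring

/-! ### The linear estimate in terms of Φ -/

theorem dyadicCount_le {s u : ℝ} (hs : 0 < s) :
    dyadicCount (ENNReal.ofReal s) (ENNReal.ofReal u) ≤
      ENNReal.ofReal (2 * (1 + Real.posLog (u / s))) := by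
  set M : ℕ := ⌈Real.posLog (u / s) / Real.log 2⌉₊ with hM
  have hl2 : 1 / 2 < Real.log 2 := by have := Real.log_two_gt_d9; linarith
  have hL : 0 ≤ Real.posLog (u / s) := Real.posLog_nonneg
  have hle : dyadicCount (ENNReal.ofReal s) (ENNReal.ofReal u) ≤ (M : ℝ≥0∞) := by
    calc dyadicCount (ENNReal.ofReal s) (ENNReal.ofReal u)
        = ∑ k ∈ Finset.range M,
            if 2 ^ k * ENNReal.ofReal s < ENNReal.ofReal u then (1 : ℝ≥0∞) else 0 := by
          refine tsum_eq_sum fun k hk => if_neg fun hlt => hk (Finset.mem_range.2 ?_)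
          rw [← ENNReal.ofReal_ofNat, ← ENNReal.ofReal_pow (by norm_num),
            ← ENNReal.ofReal_mul (by positivity), ENNReal.ofReal_lt_ofReal_iff_of_nonneg
            (by positivity)] at hlt
          have h1 : (2 : ℝ) ^ k < u / s := (lt_div_iff₀ hs).2 hlt
          have h2 : (1 : ℝ) ≤ 2 ^ k := one_le_pow₀ (by norm_num)
          have h3 : k * Real.log 2 < Real.posLog (u / s) := by
            rw [Real.posLog_eq_log (by rw [abs_of_pos (by linarith)]; linarith), ← Real.log_pow]
            exact Real.log_lt_log (by linarith) h1
          rw [hM, Nat.lt_ceil, lt_div_iff₀ (by linarith)]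
          exact h3
      _ ≤ ∑ k ∈ Finset.range M, (1 : ℝ≥0∞) := by
          refine Finset.sum_le_sum fun k _ => ?_
          split_ifs <;> simp
      _ = M := by simp
  refine hle.trans ?_
  rw [← ENNReal.ofReal_natCast]
  refine ENNReal.ofReal_le_ofReal ?_
  have h1 := Nat.ceil_lt_add_one (a := Real.posLog (u / s) / Real.log 2) (by positivity)
  have h2 : Real.posLog (u / s) / Real.log 2 ≤ 2 * Real.posLog (u / s) := by
    rw [div_le_iff₀ (by linarith)]
    nlinarith
  linarith

theorem dyadicLog_le_Phi {p : ℕ} {s u : ℝ} (hs : 0 < s) (hu : 0 ≤ u) :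
    dyadicLog p (ENNReal.ofReal s) (ENNReal.ofReal u) ≤
      ENNReal.ofReal (4 ^ p * s * Phi (p + 1) (u / s)) := by
  unfold dyadicLog
  split_ifs with h
  · have hL : 0 ≤ Real.posLog (u / s) := Real.posLog_nonneg
    calc ENNReal.ofReal u * dyadicCount (ENNReal.ofReal s) (ENNReal.ofReal u) ^ p
        ≤ ENNReal.ofReal u * ENNReal.ofReal (2 * (1 + Real.posLog (u / s))) ^ p := by
          gcongr
          exact dyadicCount_le hs
      _ = ENNReal.ofReal (u * (2 * (1 + Real.posLog (u / s))) ^ p) := by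
          rw [ENNReal.ofReal_mul hu, ENNReal.ofReal_pow (by positivity)]
      _ ≤ _ := by
          refine ENNReal.ofReal_le_ofReal ?_
          have h1 := add_pow_le zero_le_one hL p
          have h3 : (2 : ℝ) ^ (p - 1) ≤ 2 ^ p := pow_le_pow_right₀ (by norm_num) (by omega)
          rw [one_pow] at h1
          rw [mul_pow, Phi_eq, Nat.add_sub_cancel, logWeight, show (4 : ℝ) = 2 * 2 by norm_num,
            mul_pow]
          calc u * (2 ^ p * (1 + Real.posLog (u / s)) ^ p)
              ≤ u * (2 ^ p * (2 ^ p * (1 + Real.posLog (u / s) ^ p))) := by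
                gcongr
                exact h1.trans (by gcongr)
            _ = _ := by field_simp
  · exact zero_le

theorem exists_volume_rectangle_average_le {n : ℕ} (hn : 1 ≤ n) : ∃ C : ℝ, 1 ≤ C ∧
    ∀ u : (Fin n → ℝ) → ℝ, Measurable u → (∀ x, 0 ≤ u x) → ∀ t : ℝ, 0 < t →
      volume {x | ∃ R ∈ openRectangles n, x ∈ R ∧
        ENNReal.ofReal t < ⨍⁻ y in R, ENNReal.ofReal (u y) ∂volume} ≤
          ENNReal.ofReal C * ∫⁻ x, ENNReal.ofReal (Phi n (u x / t)) := by
  obtain ⟨p, rfl⟩ : ∃ p, n = p + 1 := ⟨n - 1, by omega⟩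
  obtain ⟨C, hC, hweak⟩ := volume_iterMaximal_le p
  set K : ℝ := 2 ^ p * (4 ^ (p + 1) * logWeight p (4 ^ (p + 1))) with hK
  have hK0 : 0 < K := by have := logWeight_pos p (4 ^ (p + 1)); positivity
  refine ⟨max 1 (C.toReal * (4 ^ p * K)), le_max_left _ _, fun u hu hu0 t ht => ?_⟩
  -- One factor 2^(p+1) comes from comparing averages with the iterate, the other from the level in
  -- the weak bound.
  set s : ℝ := t / 4 ^ (p + 1) with hs
  have hs0 : 0 < s := by positivity
  have hsub : {x | ∃ R ∈ openRectangles (p + 1), x ∈ R ∧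
        ENNReal.ofReal t < ⨍⁻ y in R, ENNReal.ofReal (u y) ∂volume} ⊆
      {x | 2 ^ (p + 1) * ENNReal.ofReal s <
        iterMaximal (p + 1) (fun y => ENNReal.ofReal (u y)) x} := by
    rintro x ⟨R, hR, hxR, hlt⟩
    have h1 := hlt.trans_le (setLAverage_le_iterMaximal hu.ennreal_ofReal hR hxR)
    have h2 : ENNReal.ofReal t = 2 ^ (p + 1) * (2 ^ (p + 1) * ENNReal.ofReal s) := by
      rw [← mul_assoc, ← mul_pow, show t = 4 ^ (p + 1) * s by rw [hs]; field_simp,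
        ENNReal.ofReal_mul (by positivity), ENNReal.ofReal_pow (by norm_num)]
      norm_num
    rw [h2] at h1
    exact lt_of_mul_lt_mul_left' h1
  have hpt : ∀ x, dyadicLog p (ENNReal.ofReal s) (ENNReal.ofReal (u x)) ≤
      ENNReal.ofReal (4 ^ p * s * K) * ENNReal.ofReal (Phi (p + 1) (u x / t)) := by
    intro x
    refine (dyadicLog_le_Phi hs0 (hu0 x)).trans ?_
    rw [← ENNReal.ofReal_mul (by positivity)]
    refine ENNReal.ofReal_le_ofReal ?_
    have h1 : u x / s = 4 ^ (p + 1) * (u x / t) := by rw [hs]; field_simp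
    have h2 : Phi (p + 1) (u x / s) ≤ K * Phi (p + 1) (u x / t) := by
      rw [h1]
      exact Phi_mul_le (by positivity) (div_nonneg (hu0 x) ht.le)
    calc _ ≤ 4 ^ p * s * (K * Phi (p + 1) (u x / t)) := by gcongr
      _ = _ := by ring
  calc _ ≤ C / ENNReal.ofReal s *
        ∫⁻ x, dyadicLog p (ENNReal.ofReal s) (ENNReal.ofReal (u x)) :=
        (measure_mono hsub).trans (hweak _ (by simpa using hs0) ENNReal.ofReal_ne_top _
          hu.ennreal_ofReal)
    _ ≤ C / ENNReal.ofReal s * (ENNReal.ofReal (4 ^ p * s * K) *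
        ∫⁻ x, ENNReal.ofReal (Phi (p + 1) (u x / t))) := by
        gcongr
        rw [← lintegral_const_mul' _ _ ENNReal.ofReal_ne_top]
        exact lintegral_mono hpt
    _ = ENNReal.ofReal (C.toReal * (4 ^ p * K)) * ∫⁻ x, ENNReal.ofReal (Phi (p + 1) (u x / t)) := by
        rw [← mul_assoc]
        congr 1
        rw [← ENNReal.ofReal_toReal hC, ← ENNReal.ofReal_div_of_pos hs0,
          ← ENNReal.ofReal_mul (by positivity), ENNReal.toReal_ofReal ENNReal.toReal_nonneg]
        congr 1
        field_simp
    _ ≤ _ := by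
        gcongr
        exact le_max_right _ _

/-! ### The multilinear estimate -/

/-- The set of points lying in a rectangle on which the product of the averages of the `u i`
exceeds one. -/
def superlevel {n m : ℕ} (u : Fin m → (Fin n → ℝ) → ℝ) : Set (Fin n → ℝ) :=
  {x | ∃ R ∈ openRectangles n, x ∈ R ∧ 1 < ∏ i, ⨍⁻ y in R, ENNReal.ofReal (u i y) ∂volume}

theorem isOpen_of_mem_openRectangles {n : ℕ} {R : Set (Fin n → ℝ)} (hR : R ∈ openRectangles n) :
    IsOpen R := by
  obtain ⟨a, b, -, rfl⟩ := hR
  exact isOpen_set_pi finite_univ fun _ _ => isOpen_Ioo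

theorem isOpen_superlevel {n m : ℕ} (u : Fin m → (Fin n → ℝ) → ℝ) : IsOpen (superlevel u) := by
  rw [isOpen_iff_forall_mem_open]
  rintro x ⟨R, hR, hxR, hlt⟩
  exact ⟨R, fun y hy => ⟨R, hR, hy, hlt⟩, isOpen_of_mem_openRectangles hR, hxR⟩

/-- Every admissible rectangle lies inside the level set, so each u_i may be cut off there before
the linear estimate is applied. This localization is what later permits absorption. -/
theorem exists_volume_superlevel_le {n : ℕ} (hn : 1 ≤ n) (m : ℕ) : ∃ C : ℝ, 1 ≤ C ∧
    ∀ u : Fin m → (Fin n → ℝ) → ℝ, (∀ i, Measurable (u i)) → (∀ i x, 0 ≤ u i x) →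
      ∀ t : Fin m → ℝ, (∀ i, 0 < t i) → ∏ i, t i ≤ 1 →
        volume (superlevel u) ≤ ENNReal.ofReal C *
          ∑ i, ∫⁻ x in superlevel u, ENNReal.ofReal (Phi n (u i x / t i)) := by
  obtain ⟨C, hC, h⟩ := exists_volume_rectangle_average_le hn
  refine ⟨C, hC, fun u hu hu0 t ht hprod => ?_⟩
  set E := superlevel u with hE
  have hEm : MeasurableSet E := (isOpen_superlevel u).measurableSet
  set v : Fin m → (Fin n → ℝ) → ℝ := fun i => E.indicator (u i) with hv
  have hsub : E ⊆ ⋃ i, {x | ∃ R ∈ openRectangles n, x ∈ R ∧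
      ENNReal.ofReal (t i) < ⨍⁻ y in R, ENNReal.ofReal (v i y) ∂volume} := by
    rintro x ⟨R, hR, hxR, hlt⟩
    have hRE : R ⊆ E := fun y hy => ⟨R, hR, hy, hlt⟩
    have hRm := (isOpen_of_mem_openRectangles hR).measurableSet
    have heq : ∀ i, ⨍⁻ y in R, ENNReal.ofReal (v i y) ∂volume
        = ⨍⁻ y in R, ENNReal.ofReal (u i y) ∂volume := by
      intro i
      rw [setLAverage_eq, setLAverage_eq]
      congr 1
      refine setLIntegral_congr_fun hRm fun y hy => ?_
      simp only [hv, indicator_of_mem (hRE hy)]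
    rw [mem_iUnion]
    by_contra! hcon
    refine hlt.not_ge ?_
    calc ∏ i, ⨍⁻ y in R, ENNReal.ofReal (u i y) ∂volume ≤ ∏ i, ENNReal.ofReal (t i) := by
          refine Finset.prod_le_prod' fun i _ => ?_
          by_contra! hi
          exact hcon i ⟨R, hR, hxR, by rwa [heq]⟩
      _ = ENNReal.ofReal (∏ i, t i) := (ENNReal.ofReal_prod_of_nonneg fun i _ => (ht i).le).symm
      _ ≤ 1 := by simpa using hprod
  calc volume E ≤ ∑ i, volume {x | ∃ R ∈ openRectangles n, x ∈ R ∧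
        ENNReal.ofReal (t i) < ⨍⁻ y in R, ENNReal.ofReal (v i y) ∂volume} := by
        refine (measure_mono hsub).trans ((measure_iUnion_le _).trans_eq (tsum_fintype _))
    _ ≤ ∑ i, ENNReal.ofReal C * ∫⁻ x, ENNReal.ofReal (Phi n (v i x / t i)) := by
        refine Finset.sum_le_sum fun i _ => h (v i) ((hu i).indicator hEm) ?_ (t i) (ht i)
        exact fun x => indicator_nonneg (fun x _ => hu0 i x) x
    _ = _ := by
        rw [Finset.mul_sum]
        refine Finset.sum_congr rfl fun i _ => ?_
        rw [← lintegral_indicator hEm]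
        congr 1
        refine lintegral_congr fun x => ?_
        by_cases hx : x ∈ E
        · simp [hv, hx]
        · simp [hv, hx, Phi]

theorem superlevel_eq_empty {n m : ℕ} {u : Fin m → (Fin n → ℝ) → ℝ} {i : Fin m}
    (h : ∀ᵐ x, u i x ≤ 0) : superlevel u = ∅ := by
  refine eq_empty_of_forall_notMem ?_
  rintro x ⟨R, hR, hxR, hlt⟩
  have h0 : ⨍⁻ y in R, ENNReal.ofReal (u i y) ∂volume = 0 := by
    rw [setLAverage_eq, lintegral_eq_zero_of_ae_eq_zero, ENNReal.zero_div]
    filter_upwards [ae_restrict_of_ae h] with y hy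
    simpa using hy
  rw [Finset.prod_eq_zero (Finset.mem_univ i) h0] at hlt
  simp at hlt

theorem measurable_iterate_Phi {n j : ℕ} {v : (Fin n → ℝ) → ℝ} (hv : Measurable v) :
    Measurable fun x => (Phi n)^[j] (v x) :=
  ((continuous_Phi n).iterate j).measurable.comp hv

theorem setLIntegral_Phi_div_le {n j : ℕ} {E : Set (Fin n → ℝ)} {v : (Fin n → ℝ) → ℝ}
    (hv0 : ∀ x, 0 ≤ v x) {K τ : ℝ} (hK : 1 ≤ K) (hτ : 0 < τ) :
    ∫⁻ x in E, ENNReal.ofReal (Phi n (v x / (K * τ))) ≤ ENNReal.ofReal K⁻¹ * (volume E +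
      ENNReal.ofReal (2 ^ (n - 1 + j) / balance (n - 1) j τ) *
        ∫⁻ x, ENNReal.ofReal ((Phi n)^[j + 1] (v x))) := by
  have hG := balance_pos (p := n - 1) (j := j) hτ
  have hpt : ∀ x, ENNReal.ofReal (Phi n (v x / (K * τ))) ≤ ENNReal.ofReal K⁻¹ * (1 +
      ENNReal.ofReal (2 ^ (n - 1 + j) / balance (n - 1) j τ) *
        ENNReal.ofReal ((Phi n)^[j + 1] (v x))) := by
    intro x
    have hΨ := iterate_Phi_nonneg (n := n) (j + 1) (hv0 x)
    rw [← ENNReal.ofReal_mul (by positivity), ← ENNReal.ofReal_one,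
      ← ENNReal.ofReal_add zero_le_one (by positivity), ← ENNReal.ofReal_mul (by positivity)]
    refine ENNReal.ofReal_le_ofReal ?_
    have h1 := Phi_div_le (n := n) hK (div_nonneg (hv0 x) hτ.le)
    rw [div_div, mul_comm τ K] at h1
    refine h1.trans ?_
    rw [div_eq_inv_mul]
    refine mul_le_mul_of_nonneg_left ((Phi_div_le_balance (j := j) (hv0 x) hτ).trans_eq ?_)
      (by positivity)
    ring
  calc _ ≤ ∫⁻ x in E, ENNReal.ofReal K⁻¹ * (1 +
      ENNReal.ofReal (2 ^ (n - 1 + j) / balance (n - 1) j τ) *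
        ENNReal.ofReal ((Phi n)^[j + 1] (v x))) := lintegral_mono hpt
    _ = ENNReal.ofReal K⁻¹ * (volume E +
      ENNReal.ofReal (2 ^ (n - 1 + j) / balance (n - 1) j τ) *
        ∫⁻ x in E, ENNReal.ofReal ((Phi n)^[j + 1] (v x))) := by
        rw [lintegral_const_mul' _ _ ENNReal.ofReal_ne_top, lintegral_add_left measurable_const,
          lintegral_const_mul' _ _ ENNReal.ofReal_ne_top]
        simp
    _ ≤ _ := by
        gcongr
        exact Measure.restrict_le_self

theorem exists_volume_superlevel_le_rpow {n : ℕ} (hn : 1 ≤ n) (j : ℕ) : ∃ C : ℝ, 0 < C ∧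
    ∀ u : Fin (j + 1) → (Fin n → ℝ) → ℝ, (∀ i, Measurable (u i)) → (∀ i x, 0 ≤ u i x) →
      volume (superlevel u) ≤ ENNReal.ofReal C *
        (∏ i, ∫⁻ x, ENNReal.ofReal ((Phi n)^[j + 1] (u i x))) ^ (1 / ((j + 1 : ℕ) : ℝ)) := by
  obtain ⟨A, hA, hweak⟩ := exists_volume_superlevel_le hn (j + 1)
  set D : ℝ := 2 ^ (n - 1 + j) with hD
  -- Chosen so that A (j + 1) (1 + D) / K = 1/2.
  set K : ℝ := 2 * A * (j + 1) * (1 + D) with hK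
  have hD1 : 1 ≤ D := one_le_pow₀ (by norm_num)
  have hK1 : 1 ≤ K := by
    have h1 : 1 ≤ 2 * A := by linarith
    have h2 : (1 : ℝ) ≤ j + 1 := by linarith [j.cast_nonneg (α := ℝ)]
    exact one_le_mul_of_one_le_of_one_le (one_le_mul_of_one_le_of_one_le h1 h2) (by linarith)
  have hK0 : 0 < K := by linarith
  obtain ⟨c, hc, hbal⟩ := exists_le_prod_balance (n - 1) j (κ := (K ^ (j + 1))⁻¹) (by positivity)
  refine ⟨c⁻¹ ^ (1 / ((j + 1 : ℕ) : ℝ)), by positivity, fun u hu hu0 => ?_⟩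
  set I : Fin (j + 1) → ℝ≥0∞ := fun i => ∫⁻ x, ENNReal.ofReal ((Phi n)^[j + 1] (u i x)) with hI
  set E := superlevel u with hE
  -- The convention 0 · ∞ = 0 matters here: one vanishing integral must already empty the level set.
  by_cases hz : ∃ i, I i = 0
  · obtain ⟨i, hi⟩ := hz
    have h1 : E = ∅ := by
      refine superlevel_eq_empty (i := i) ?_
      rw [hI, lintegral_eq_zero_iff (measurable_iterate_Phi (hu i)).ennreal_ofReal] at hi
      filter_upwards [hi] with x hx
      exact (le_iterate_Phi (j + 1) (hu0 i x)).trans (by simpa using hx)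
    simp [h1]
  push Not at hz
  by_cases hinf : ∃ i, I i = ∞
  · obtain ⟨i, hi⟩ := hinf
    have h1 : ∏ i, I i = ∞ := by
      rw [← Finset.mul_prod_erase _ _ (Finset.mem_univ i), hi, ENNReal.top_mul]
      exact Finset.prod_ne_zero_iff.2 fun l _ => hz l
    rw [h1, ENNReal.top_rpow_of_pos (by positivity), ENNReal.mul_top]
    · exact le_top
    · simp only [ne_eq, ENNReal.ofReal_eq_zero, not_le]
      positivity
  push Not at hinf
  -- Absorption needs finite volume; all t_i = 1 give it, since Φ ≤ Φ^(j+1).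
  have hVtop : volume E ≠ ∞ := by
    refine ((hweak u hu hu0 (fun _ => 1) (by simp) (by simp)).trans_lt ?_).ne
    refine ENNReal.mul_lt_top ENNReal.ofReal_lt_top (ENNReal.sum_lt_top.2 fun i _ => ?_)
    refine lt_of_le_of_lt ?_ (hinf i).lt_top
    refine (setLIntegral_le_lintegral _ _).trans (lintegral_mono fun x => ?_)
    rw [div_one, Function.iterate_succ_apply]
    exact ENNReal.ofReal_le_ofReal (le_iterate_Phi j (Phi_nonneg (hu0 i x)))
  by_cases hV0 : volume E = 0
  · simp [hV0]
  set V : ℝ := (volume E).toReal with hV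
  have hVpos : 0 < V := ENNReal.toReal_pos hV0 hVtop
  have hVE : volume E = ENNReal.ofReal V := (ENNReal.ofReal_toReal hVtop).symm
  have hIpos : ∀ i, 0 < (I i).toReal := fun i => ENNReal.toReal_pos (hz i) (hinf i)
  have hIE : ∀ i, I i = ENNReal.ofReal (I i).toReal :=
    fun i => (ENNReal.ofReal_toReal (hinf i)).symm
  choose τ hτ0 hτ using fun i => exists_balance_eq (n - 1) j (div_pos (hIpos i) hVpos)
  have hκ : (K ^ (j + 1))⁻¹ ≤ ∏ i, τ i := by
    by_contra! hlt
    have hprod : ∏ i, K * τ i ≤ 1 := by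
      rw [Finset.prod_mul_distrib, Finset.prod_const, Finset.card_univ, Fintype.card_fin]
      calc K ^ (j + 1) * ∏ i, τ i ≤ K ^ (j + 1) * (K ^ (j + 1))⁻¹ := by gcongr
        _ = 1 := mul_inv_cancel₀ (by positivity)
    have h1 := hweak u hu hu0 (fun i => K * τ i) (fun i => mul_pos hK0 (hτ0 i)) hprod
    have h2 : volume E ≤ ENNReal.ofReal A * ∑ i : Fin (j + 1),
        ENNReal.ofReal (K⁻¹ * ((1 + D) * V)) := by
      refine h1.trans ?_
      gcongr with i
      refine (setLIntegral_Phi_div_le (j := j) (hu0 i) hK1 (hτ0 i)).trans_eq ?_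
      have hI0 := hIpos i
      change ENNReal.ofReal K⁻¹ * (volume E + ENNReal.ofReal (D / _) * I i) = _
      rw [hVE, hIE i, hτ i, ← ENNReal.ofReal_mul (by positivity),
        ← ENNReal.ofReal_add hVpos.le (by positivity), ← ENNReal.ofReal_mul (by positivity)]
      congr 2
      field_simp
    rw [hVE, Finset.sum_const, Finset.card_univ, Fintype.card_fin, nsmul_eq_mul,
      ← ENNReal.ofReal_natCast, ← ENNReal.ofReal_mul (by positivity),
      ← ENNReal.ofReal_mul (by positivity), ENNReal.ofReal_le_ofReal_iff (by positivity)] at h2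
    have h3 : A * (((j + 1 : ℕ) : ℝ) * (K⁻¹ * ((1 + D) * V))) = V / 2 := by
      rw [hK]
      push_cast
      have : A ≠ 0 := by positivity
      field_simp
    linarith
  have hfin := hbal τ hτ0 hκ
  have h1 : ∏ i, balance (n - 1) j (τ i) = (∏ i, (I i).toReal) / V ^ (j + 1) := by
    simp only [hτ, Finset.prod_div_distrib, Finset.prod_const, Finset.card_univ, Fintype.card_fin]
  rw [h1, le_div_iff₀ (by positivity)] at hfin
  have h2 : volume E ^ (j + 1) ≤ ENNReal.ofReal c⁻¹ * ∏ i, I i := by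
    rw [Finset.prod_congr rfl fun i _ => hIE i,
      ← ENNReal.ofReal_prod_of_nonneg fun i _ => (hIpos i).le, hVE,
      ← ENNReal.ofReal_pow hVpos.le, ← ENNReal.ofReal_mul (by positivity)]
    refine ENNReal.ofReal_le_ofReal ?_
    rw [inv_mul_eq_div, le_div_iff₀ hc, mul_comm]
    exact hfin
  calc volume E = (volume E ^ (j + 1)) ^ (1 / ((j + 1 : ℕ) : ℝ)) := by
        rw [one_div, ENNReal.pow_rpow_inv_natCast (by omega)]
    _ ≤ (ENNReal.ofReal c⁻¹ * ∏ i, I i) ^ (1 / ((j + 1 : ℕ) : ℝ)) := by gcongr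
    _ = _ := by
        rw [ENNReal.mul_rpow_of_nonneg _ _ (by positivity),
          ENNReal.ofReal_rpow_of_pos (by positivity)]

theorem exists_distributionalEstimate {n m : ℕ} (hn : 1 ≤ n) (hm : 1 ≤ m) :
    ∃ C : ℝ, 0 < C ∧ DistributionalEstimate n m (Phi n)^[m] C := by
  obtain ⟨j, rfl⟩ : ∃ j, m = j + 1 := ⟨m - 1, by omega⟩
  obtain ⟨C, hC, h⟩ := exists_volume_superlevel_le_rpow hn j
  refine ⟨C, hC, fun lam hlam f hf => ?_⟩
  -- Passing to measurable representatives changes neither the averages nor the integrals.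
  set g : Fin (j + 1) → (Fin n → ℝ) → ℂ := fun i => (hf i).aestronglyMeasurable.mk (f i) with hg
  have hgm : ∀ i, Measurable (g i) := fun i =>
    (hf i).aestronglyMeasurable.stronglyMeasurable_mk.measurable
  have hfg : ∀ i, f i =ᵐ[volume] g i := fun i => (hf i).aestronglyMeasurable.ae_eq_mk
  set u : Fin (j + 1) → (Fin n → ℝ) → ℝ := fun i x => ‖g i x‖ / lam with hu
  have havg : ∀ i (R : Set (Fin n → ℝ)), ⨍⁻ y in R, ‖f i y‖ₑ ∂volume
      = ENNReal.ofReal lam * ⨍⁻ y in R, ENNReal.ofReal (u i y) ∂volume := by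
    intro i R
    rw [setLAverage_eq, setLAverage_eq, ← mul_div_assoc,
      ← lintegral_const_mul' _ _ ENNReal.ofReal_ne_top]
    congr 1
    refine lintegral_congr_ae (ae_restrict_of_ae ?_)
    filter_upwards [hfg i] with y hy
    rw [← ENNReal.ofReal_mul hlam.le, hy, hu, mul_div_cancel₀ _ hlam.ne', ofReal_norm]
  have hset : {x : Fin n → ℝ | ENNReal.ofReal (lam ^ (j + 1)) < strongMaximal f x}
      ⊆ superlevel u := by
    intro x hx
    simp only [mem_ofPred_eq, strongMaximal, lt_iSup_iff] at hx
    obtain ⟨R, ⟨hR, hxR⟩, hlt⟩ := hx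
    refine ⟨R, hR, hxR, ?_⟩
    simp only [havg] at hlt
    rw [Finset.prod_mul_distrib, Finset.prod_const, Finset.card_univ, Fintype.card_fin,
      ← ENNReal.ofReal_pow hlam.le] at hlt
    by_contra! hcon
    exact hlt.not_ge (mul_le_of_le_one_right zero_le hcon)
  refine (measure_mono hset).trans ((h u (fun i => (hgm i).norm.div_const _)
    fun i x => by positivity).trans_eq ?_)
  congr 2
  refine Finset.prod_congr rfl fun i _ => lintegral_congr_ae ?_
  filter_upwards [hfg i] with y hy
  rw [hy]

/-! ### Sharpness -/

/-- Because 1 + log Φ(T) ≤ (1 + p)(1 + log T), each further application of Φ contributes just one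
more factor (1 + log T)^p. -/
theorem exists_iterate_Phi_le {p : ℕ} (hp : 1 ≤ p) (k : ℕ) : ∃ K : ℝ, 0 < K ∧ ∀ T : ℝ, 1 ≤ T →
    (Phi (p + 1))^[k] T ≤ K * T * (1 + Real.log T) ^ (p * k) := by
  induction k with
  | zero => exact ⟨1, one_pos, fun T _ => by simp⟩
  | succ k ih =>
    obtain ⟨K, hK, h⟩ := ih
    refine ⟨K * (1 + p) ^ (p * k), by positivity, fun T hT => ?_⟩
    have hT0 : 0 < T := by linarith
    have hL : 0 ≤ Real.log T := Real.log_nonneg hT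
    have h1 : Phi (p + 1) T ≤ T * (1 + Real.log T) ^ p := by
      rw [Phi_eq, Nat.add_sub_cancel, logWeight,
        Real.posLog_eq_log (by rwa [abs_of_pos hT0])]
      gcongr
      simpa using pow_add_pow_le zero_le_one hL (n := p) (by omega)
    have h2 : 1 ≤ Phi (p + 1) T := hT.trans (le_Phi hT0.le)
    have h3 : 1 + Real.log (Phi (p + 1) T) ≤ (1 + p) * (1 + Real.log T) := by
      have h4 := Real.log_le_log (by linarith) h1
      rw [Real.log_mul hT0.ne' (by positivity), Real.log_pow] at h4
      have h5 : Real.log (1 + Real.log T) ≤ Real.log T := by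
        have := Real.log_le_sub_one_of_pos (show 0 < 1 + Real.log T by linarith)
        linarith
      have h6 : (p : ℝ) * Real.log (1 + Real.log T) ≤ p * Real.log T := by gcongr
      have h7 : (0 : ℝ) ≤ p := p.cast_nonneg
      linarith
    have h8 : 0 ≤ Real.log (Phi (p + 1) T) := Real.log_nonneg h2
    rw [Function.iterate_succ_apply]
    calc _ ≤ K * Phi (p + 1) T * (1 + Real.log (Phi (p + 1) T)) ^ (p * k) := h _ h2
      _ ≤ K * (T * (1 + Real.log T) ^ p) * ((1 + p) * (1 + Real.log T)) ^ (p * k) := by gcongr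
      _ = _ := by rw [mul_pow, Nat.mul_succ, pow_add]; ring

theorem iterate_Phi_one {p : ℕ} (hp : 1 ≤ p) (k : ℕ) : (Phi (p + 1))^[k] 1 = 1 :=
  Function.iterate_fixed (by simp [Phi, show p ≠ 0 by omega]) k

theorem iterate_Phi_zero (n k : ℕ) : (Phi n)^[k] 0 = 0 :=
  Function.iterate_fixed (by simp [Phi]) k

/-- The exponents of the dyadic box with index `κ`; they add up to `p * q`. -/
def boxExponent {p q : ℕ} (κ : Fin p → Fin q) : Fin (p + 1) → ℕ :=
  Fin.cons (p * q - ∑ i, (κ i : ℕ)) fun i => κ i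

theorem sum_boxExponent {p q : ℕ} (κ : Fin p → Fin q) : ∑ i, boxExponent κ i = p * q := by
  have h : ∑ i, (κ i : ℕ) ≤ p * q :=
    (Finset.sum_le_sum fun i _ => (κ i).isLt.le).trans_eq (by simp)
  rw [Fin.sum_univ_succ]
  simp only [boxExponent, Fin.cons_zero, Fin.cons_succ]
  omega

/-- The dyadic box with index `κ`. -/
def dyadicBox {p q : ℕ} (κ : Fin p → Fin q) : Set (Fin (p + 1) → ℝ) :=
  univ.pi fun i => Ico ((2 : ℝ) ^ boxExponent κ i) (2 ^ (boxExponent κ i + 1))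

theorem volume_dyadicBox {p q : ℕ} (κ : Fin p → Fin q) :
    volume (dyadicBox κ) = ENNReal.ofReal (2 ^ (p * q)) := by
  rw [dyadicBox, Real.volume_pi_Ico, ← sum_boxExponent κ, ← Finset.prod_pow_eq_pow_sum,
    ENNReal.ofReal_prod_of_nonneg fun _ _ => by positivity]
  refine Finset.prod_congr rfl fun i _ => ?_
  congr 1
  ring

theorem pairwise_disjoint_dyadicBox (p q : ℕ) :
    Pairwise (Function.onFun Disjoint (dyadicBox (p := p) (q := q))) := by
  intro κ κ' hne
  refine Set.disjoint_left.2 fun x hx hx' => hne (funext fun i => Fin.ext ?_)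
  have h1 := hx i.succ (mem_univ _)
  have h2 := hx' i.succ (mem_univ _)
  simp only [boxExponent, Fin.cons_succ, mem_Ico] at h1 h2
  have h3 := (pow_lt_pow_iff_right₀ (one_lt_two (α := ℝ))).1 (h1.1.trans_lt h2.2)
  have h4 := (pow_lt_pow_iff_right₀ (one_lt_two (α := ℝ))).1 (h2.1.trans_lt h1.2)
  omega

theorem volume_iUnion_dyadicBox (p q : ℕ) :
    volume (⋃ κ : Fin p → Fin q, dyadicBox κ) = ENNReal.ofReal (q ^ p * 2 ^ (p * q)) := by
  rw [measure_iUnion (pairwise_disjoint_dyadicBox p q)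
    fun κ => MeasurableSet.univ_pi fun i => measurableSet_Ico, tsum_fintype]
  simp only [volume_dyadicBox, Finset.sum_const, Finset.card_univ, Fintype.card_fun,
    Fintype.card_fin, nsmul_eq_mul]
  rw [ENNReal.ofReal_mul (by positivity), ← ENNReal.ofReal_natCast]
  push_cast
  rfl

/-- The open unit cube. -/
def unitCube (n : ℕ) : Set (Fin n → ℝ) := univ.pi fun _ => Ioo 0 1

theorem measurableSet_unitCube (n : ℕ) : MeasurableSet (unitCube n) :=
  MeasurableSet.univ_pi fun _ => measurableSet_Ioo

theorem volume_unitCube (n : ℕ) : volume (unitCube n) = 1 := by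
  simp [unitCube, Real.volume_pi_Ioo]

/-- The test rectangle runs from the origin to the upper corner of the box: it contains both the box
and the unit cube, and its volume does not depend on κ. -/
theorem prod_div_le_strongMaximal {p q m : ℕ} (a : Fin m → ℝ) (ha : ∀ i, 0 ≤ a i)
    {κ : Fin p → Fin q} {x : Fin (p + 1) → ℝ} (hx : x ∈ dyadicBox κ) :
    ENNReal.ofReal (∏ i, a i / 2 ^ (p * q + (p + 1))) ≤
      strongMaximal (fun i => (unitCube (p + 1)).indicator fun _ => (a i : ℂ)) x := by
  set R : Set (Fin (p + 1) → ℝ) := univ.pi fun i => Ioo 0 (2 ^ (boxExponent κ i + 1)) with hR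
  have hRmem : R ∈ openRectangles (p + 1) :=
    ⟨fun _ => 0, fun i => 2 ^ (boxExponent κ i + 1), fun i => by positivity, rfl⟩
  have hxR : x ∈ R := fun i hi =>
    ⟨(by positivity : (0 : ℝ) < 2 ^ boxExponent κ i).trans_le (hx i hi).1, (hx i hi).2⟩
  have hsub : unitCube (p + 1) ⊆ R := fun y hy i hi =>
    ⟨(hy i hi).1, (hy i hi).2.trans_le (one_le_pow₀ one_le_two)⟩
  have hvol : volume R = ENNReal.ofReal (2 ^ (p * q + (p + 1))) := by
    rw [hR, Real.volume_pi_Ioo, ← ENNReal.ofReal_prod_of_nonneg fun _ _ => by simp]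
    simp only [sub_zero, Finset.prod_pow_eq_pow_sum, Finset.sum_add_distrib, sum_boxExponent]
    simp
  have havg : ∀ i, ⨍⁻ y in R, ‖(unitCube (p + 1)).indicator (fun _ => (a i : ℂ)) y‖ₑ ∂volume
      = ENNReal.ofReal (a i / 2 ^ (p * q + (p + 1))) := by
    intro i
    have h1 : ∀ y, ‖(unitCube (p + 1)).indicator (fun _ => (a i : ℂ)) y‖ₑ
        = (unitCube (p + 1)).indicator (fun _ => ENNReal.ofReal (a i)) y := by
      intro y
      by_cases hy : y ∈ unitCube (p + 1)
      · rw [indicator_of_mem hy, indicator_of_mem hy, ← ofReal_norm, Complex.norm_real,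
          Real.norm_of_nonneg (ha i)]
      · simp [hy]
    rw [setLAverage_eq, hvol]
    simp only [h1]
    rw [lintegral_indicator_const (measurableSet_unitCube _),
      Measure.restrict_apply (measurableSet_unitCube _), inter_eq_left.2 hsub, volume_unitCube,
      mul_one, ENNReal.ofReal_div_of_pos (by positivity)]
  rw [ENNReal.ofReal_prod_of_nonneg fun i _ => div_nonneg (ha i) (by positivity),
    ← Finset.prod_congr rfl fun i _ => havg i]
  exact le_iSup₂_of_le R ⟨hRmem, hxR⟩ le_rfl

theorem lintegral_iterate_Phi_indicator {n k : ℕ} {a : ℝ} (ha : 0 ≤ a) :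
    ∫⁻ x : Fin n → ℝ, ENNReal.ofReal ((Phi n)^[k]
      (‖(unitCube n).indicator (fun _ => (a : ℂ)) x‖ / 1)) = ENNReal.ofReal ((Phi n)^[k] a) := by
  have h1 : ∀ x : Fin n → ℝ, ENNReal.ofReal ((Phi n)^[k]
      (‖(unitCube n).indicator (fun _ => (a : ℂ)) x‖ / 1))
      = (unitCube n).indicator (fun _ => ENNReal.ofReal ((Phi n)^[k] a)) x := by
    intro x
    by_cases hx : x ∈ unitCube n
    · simp [hx, abs_of_nonneg ha]
    · simp [hx, iterate_Phi_zero]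
  simp only [h1]
  rw [lintegral_indicator_const (measurableSet_unitCube n), volume_unitCube, mul_one]

theorem pow_le_of_distributionalEstimate {p j k q : ℕ} (hp : 1 ≤ p) {C : ℝ} (hC : 0 < C)
    (h : DistributionalEstimate (p + 1) (j + 1) (Phi (p + 1))^[k] C) :
    ((q : ℝ) ^ p * 2 ^ (p * q)) ^ (j + 1) ≤
      C ^ (j + 1) * (Phi (p + 1))^[k] ((2 ^ (p * q + p + 2)) ^ (j + 1)) := by
  set N : ℝ := 2 ^ (p * q + p + 2) with hN
  have hN0 : 0 < N := by positivity
  set a : Fin (j + 1) → ℝ := Fin.cons (N ^ (j + 1)) fun _ => 1 with ha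
  have ha0 : ∀ i, 0 ≤ a i := by
    refine Fin.cases ?_ fun i => ?_
    · simp only [ha, Fin.cons_zero]; positivity
    · simp [ha]
  have hest := h 1 one_pos (fun i => (unitCube (p + 1)).indicator fun _ => (a i : ℂ)) fun i =>
    ((integrable_indicator_iff (measurableSet_unitCube _)).2
      (integrableOn_const (by simp [volume_unitCube]))).locallyIntegrable
  have hsub : (⋃ κ : Fin p → Fin q, dyadicBox κ) ⊆
      {x : Fin (p + 1) → ℝ | ENNReal.ofReal (1 ^ (j + 1)) <
        strongMaximal (fun i => (unitCube (p + 1)).indicator fun _ => (a i : ℂ)) x} := by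
    refine iUnion_subset fun κ x hx => ?_
    refine lt_of_lt_of_le ?_ (prod_div_le_strongMaximal a ha0 hx)
    have h1 : ∏ i, a i / 2 ^ (p * q + (p + 1)) = 2 ^ (j + 1) := by
      rw [Finset.prod_div_distrib, Finset.prod_const, Finset.card_univ, Fintype.card_fin,
        Fin.prod_univ_succ]
      simp only [ha, Fin.cons_zero, Fin.cons_succ, Finset.prod_const_one, mul_one]
      rw [← div_pow, hN]
      congr 1
      rw [div_eq_iff (by positivity)]
      ring
    rw [h1, one_pow, ENNReal.ofReal_lt_ofReal_iff (by positivity)]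
    exact one_lt_pow₀ one_lt_two (by omega)
  have hΨ0 : 0 ≤ (Phi (p + 1))^[k] (N ^ (j + 1)) := iterate_Phi_nonneg k (by positivity)
  have h1 := (measure_mono hsub).trans hest
  simp only [lintegral_iterate_Phi_indicator (ha0 _)] at h1
  rw [volume_iUnion_dyadicBox, Fin.prod_univ_succ] at h1
  simp only [ha, Fin.cons_zero, Fin.cons_succ, iterate_Phi_one hp, ENNReal.ofReal_one,
    Finset.prod_const_one, mul_one] at h1
  have h2 := pow_le_pow_left₀ zero_le h1 (j + 1)
  rw [mul_pow, ← ENNReal.rpow_mul_natCast, one_div, inv_mul_cancel₀ (by positivity),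
    ENNReal.rpow_one, ← ENNReal.ofReal_pow (by positivity), ← ENNReal.ofReal_pow hC.le,
    ← ENNReal.ofReal_mul (by positivity), ENNReal.ofReal_le_ofReal_iff (by positivity)] at h2
  exact h2

theorem not_exists_distributionalEstimate {n m k : ℕ} (hn : 2 ≤ n) (hm : 1 ≤ m) (hk : k ≤ m - 1) :
    ¬ ∃ C : ℝ, 0 < C ∧ DistributionalEstimate n m (Phi n)^[k] C := by
  rintro ⟨C, hC, h⟩
  obtain ⟨p, rfl⟩ : ∃ p, n = p + 1 := ⟨n - 1, by omega⟩
  obtain ⟨j, rfl⟩ : ∃ j, m = j + 1 := ⟨m - 1, by omega⟩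
  have hp : 1 ≤ p := by omega
  obtain ⟨K, hK, hΦ⟩ := exists_iterate_Phi_le hp k
  set B : ℝ := 1 + (j + 1) * (2 * p + 2) with hB
  have hB0 : 0 < B := by positivity
  set Q : ℝ := C ^ (j + 1) * (K * 2 ^ ((p + 2) * (j + 1)) * B ^ (p * k)) with hQ
  have hQ0 : 0 < Q := by positivity
  obtain ⟨q, hq⟩ := exists_nat_gt (max 1 Q)
  have hq1 : (1 : ℝ) ≤ q := (le_max_left _ _).trans hq.le
  have hqQ : Q < q := (le_max_right _ _).trans_lt hq
  have hest := pow_le_of_distributionalEstimate (q := q) hp hC h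
  set T : ℝ := (2 ^ (p * q + p + 2)) ^ (j + 1) with hT
  have hT1 : 1 ≤ T := one_le_pow₀ (one_le_pow₀ one_le_two)
  have hlog : 1 + Real.log T ≤ B * q := by
    rw [hT, Real.log_pow, Real.log_pow]
    push_cast
    have h1 : Real.log 2 ≤ 1 := by have := Real.log_two_lt_d9; linarith
    have h2 : ((p : ℝ) * q + p + 2) * Real.log 2 ≤ (2 * p + 2) * q := by
      have h3 : ((p : ℝ) * q + p + 2) * Real.log 2 ≤ ((p : ℝ) * q + p + 2) * 1 := by gcongr
      have h4 : (p : ℝ) ≤ p * q := le_mul_of_one_le_right p.cast_nonneg hq1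
      nlinarith
    calc _ ≤ 1 + ((j : ℝ) + 1) * ((2 * p + 2) * q) := by gcongr
      _ ≤ B * q := by rw [hB]; linarith
  have hTeq : T = 2 ^ ((p + 2) * (j + 1)) * (2 ^ (p * q)) ^ (j + 1) := by
    rw [hT, pow_mul, ← mul_pow, ← pow_add]
    congr 2
    omega
  have hlog0 : 0 ≤ Real.log T := Real.log_nonneg hT1
  have h1 : ((q : ℝ) ^ p * 2 ^ (p * q)) ^ (j + 1) ≤
      C ^ (j + 1) * (K * T * (B * q) ^ (p * k)) := by
    refine hest.trans ?_
    gcongr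
    refine (hΦ T hT1).trans ?_
    gcongr
  have h2 : (q : ℝ) ^ (p * (j + 1)) ≤ Q * q ^ (p * k) := by
    refine le_of_mul_le_mul_right ?_ (show (0 : ℝ) < (2 ^ (p * q)) ^ (j + 1) by positivity)
    calc (q : ℝ) ^ (p * (j + 1)) * (2 ^ (p * q)) ^ (j + 1)
        = ((q : ℝ) ^ p * 2 ^ (p * q)) ^ (j + 1) := by rw [mul_pow, pow_mul]
      _ ≤ _ := h1
      _ = _ := by rw [hTeq, hQ, mul_pow]; ring
  -- As k ≤ j and p ≥ 1, at least one spare power of q remains to beat Q.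
  have h3 : (q : ℝ) ^ (p * k + 1) ≤ (q : ℝ) ^ (p * (j + 1)) := by
    refine pow_le_pow_right₀ hq1 ?_
    have h4 : p * (k + 1) ≤ p * (j + 1) := Nat.mul_le_mul_left p (by omega)
    rw [Nat.mul_succ] at h4
    omega
  have h5 : (q : ℝ) ^ (p * k + 1) = q * q ^ (p * k) := pow_succ' _ _
  have h6 : (0 : ℝ) < q ^ (p * k) := by positivity
  have h7 : Q * (q : ℝ) ^ (p * k) < q * q ^ (p * k) := by gcongr
  linarith

theorem mainTheorem2 (n m : ℕ) (hn : 1 ≤ n) (hm : 1 ≤ m) :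
    (∃ C : ℝ, 0 < C ∧ DistributionalEstimate n m (Phi n)^[m] C) ∧
      (2 ≤ n → ∀ k : ℕ, k ≤ m - 1 →
        ¬ ∃ C : ℝ, 0 < C ∧ DistributionalEstimate n m (Phi n)^[k] C) :=
  ⟨exists_distributionalEstimate hn hm, fun hn2 _ hk => not_exists_distributionalEstimate hn2 hm hk⟩
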